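/- Let $\mathbb{D}$ be the open unit disk and $\mathcal{B}_*$ the class of all analytic $f$ in $\mathbb{D}$ with $0<|f(z)|\le 1$ for all $z\in\mathbb{D}$; put $M_n=\sup\{|f^{(n)}(0)|/n! : f\in\mathcal{B}_*\}$. Write $f(z)=\sum_{j\ge0} a_jz^j$. A function is called *extremal* if it maximizes $\mathrm{Re}\,a_n$ among all $f\in\mathcal{B}_*$ with $a_0>0$. Let $n\ge 2$. If $f$ is extremal, then $a_n>0$ and $f=e^g$ for some analytic $g(z)=\sum_{j\ge0} b_jz^j$ in $\mathbb{D}$ with $b_0$ real and $b_0<0$. Notation, for an extremal $f$ and such a $g$: * The recursion $(\ast)$ is $a_m=\sum_{j=1}^m \frac jm a_{m-j}b_j$, $1\le m\le n$. With $a_0$ fixed, a set $I\subset\{1,\dots,n-1\}$ is *$n$-inductive* if $a_n=a_0b_n$ for all $(a_1,\dots,a_n),(b_1,\dots,b_n)\in\mathbb{C}^n$ satisfying $(\ast)$ with $a_i=0$ for $i\in I$; a set $J\subset\{1,\dots,n-1\}$ is *exponentially $n$-inductive* if $a_n=a_0b_n$ for all such vectors satisfying $(\ast)$ with $b_j=0$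 for $j\in J$. * $P(z)=a_n+2a_{n-1}z+\dots+2a_1z^{n-1}+2a_0z^n$, with zeros $\lambda_1,\dots,\lambda_n$, counted with multiplicity. * $W_nf(z)=\frac1n\sum_{k=0}^{n-1}f(e^{2\pi ik/n}z)=H_f(z^n)$, where $H_f(z)=\sum_{k\ge0}a_{nk}z^k$. Write $H_f=BG$ with $B$ a Blaschke product (possibly constant, up to a unimodular factor) normalized by $B(0)>0$, and $G$ analytic and zero-free in $\mathbb{D}$ with $\|G\|_\infty=\|H_f\|_\infty\le1$; put $B_0=B(0)$. **(I)** The following are equivalent: * (a) $a_n=2a_0$; * (b) $a_k=0$ for $1\le k<n$ (which is equivalent to $b_k=0$ for $1\le k<n$); * (c) $f(z)=e^{(z^n-1)/(z^n+1)}$ (and in particular, in this case, $M_n=2/e$); * (d) $\{i : 1\le i\le n-1,\ a_i=0\}$ is $n$-inductive; * (e) $\{j : 1\le j\le n-1,\ b_j=0\}$ is exponentially $n$-inductive; * (f) $g(z)=(z^kH(z)-1)/(z^kH(z)+1)$ for some analytic $H$ in $\mathbb{D}$ with $|H|\le1$ and some $k\in\mathbb{N}$, $k\ge n/2$; * (g)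 $(-1)^n\prod_{k=1}^n\lambda_k=1$; * (h) $|\lambda_k|=1$ for all $k$; * (i) $\lambda_1,\dots,\lambda_n$ are the $n$-th roots of $-1$; * (j) $a_nb_0+a_0\,\mathrm{Re}\,b_n=0$; * (k) $\mathrm{Re}\{a_1b_{n-1}+a_2b_{n-2}+\dots+a_{n-1}b_1\}=0$; * (l) $a_n=a_0\,\mathrm{Re}\,b_n$; * (m) $\mathrm{Re}\,b_n=2|b_0|$, and $f(z)=\exp\bigl(\sum_{j=1}^N r_j\frac{\alpha_jz+1}{\alpha_jz-1}\bigr)$ with $N=n$, distinct $\alpha_j$ of modulus one and $r_1=\dots=r_n>0$; * (n) $B_0=1$; * (o) $W_nf$ has no zero in $\mathbb{D}$; * (p) $W_nf=f$; * (q) $g=W_ng$. **(II)** There is a unique extremal function if and only if every extremal function satisfies some one of the conditions (a)–(q), and equivalently if and only if every extremal function satisfies all of them. -/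

import Mathlib

open Metric Set

noncomputable section

namespace Krzyz

/-- The open unit disk. -/
def disk : Set ℂ := ball (0 : ℂ) 1

/-- The `k`-th Taylor coefficient of `f` at the origin. -/
def coeff (f : ℂ → ℂ) (k : ℕ) : ℂ := iteratedDeriv k f 0 / (Nat.factorial k : ℂ)

/-- The class of all analytic functions `f` in the disk with `0 < |f| ≤ 1`. Only the values of `f`
in the disk matter. -/
def BStar (f : ℂ → ℂ) : Prop :=
  DifferentiableOn ℂ f disk ∧ ∀ z ∈ disk, 0 < ‖f z‖ ∧ ‖f z‖ ≤ 1

/-- `M_n`, the supremum of `|f⁽ⁿ⁾(0)| / n!` over the class `BStar`. -/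
def M (n : ℕ) : ℝ := sSup {x : ℝ | ∃ f : ℂ → ℂ, BStar f ∧ x = ‖coeff f n‖}

/-- Admissible functions for the normalized problem: `f` is in the class `BStar` and `a_0 > 0`. -/
def Normalized (f : ℂ → ℂ) : Prop :=
  BStar f ∧ (coeff f 0).im = 0 ∧ 0 < (coeff f 0).re

/-- `f` is extremal for the normalized problem: it maximizes `Re a_n` over all functions in `BStar`
with `a_0 > 0`. -/
def IsExtremal (n : ℕ) (f : ℂ → ℂ) : Prop :=
  Normalized f ∧ ∀ h : ℂ → ℂ, Normalized h → (coeff h n).re ≤ (coeff f n).re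

/-- `f = e^g` in the disk, with `g` analytic and `b_0 = g(0)` real and negative. -/
def IsNormalizedLog (f g : ℂ → ℂ) : Prop :=
  DifferentiableOn ℂ g disk ∧ (∀ z ∈ disk, f z = Complex.exp (g z)) ∧
    (coeff g 0).im = 0 ∧ (coeff g 0).re < 0

/-- There is exactly one extremal function (functions are compared on the disk). -/
def UniqueExtremal (n : ℕ) : Prop :=
  ∃ f : ℂ → ℂ, IsExtremal n f ∧ ∀ h : ℂ → ℂ, IsExtremal n h → EqOn h f disk

/-- The function `e^{(z^n - 1)/(z^n + 1)}`. -/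
def krzyzFun (n : ℕ) (z : ℂ) : ℂ := Complex.exp ((z ^ n - 1) / (z ^ n + 1))

/-- The recursion `a_m = ∑_{j=1}^m (j/m) a_{m-j} b_j`, `1 ≤ m ≤ n`, between the Taylor coefficients
of a function and of its logarithm. -/
def Recursion (n : ℕ) (a b : ℕ → ℂ) : Prop :=
  ∀ m : ℕ, 1 ≤ m → m ≤ n →
    a m = ∑ j ∈ Finset.Icc 1 m, (j : ℂ) / (m : ℂ) * a (m - j) * b j

/-- `I` is `n`-inductive (for the given value `a0` of the zeroth coefficient): `a_n = a_0 b_n` for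
all `a`, `b` that satisfy the recursion and such that `a` vanishes on `I`. Only the entries
`a 1, …, a n` and `b 1, …, b n` matter. -/
def IsInductive (n : ℕ) (a0 : ℂ) (I : Set ℕ) : Prop :=
  ∀ a b : ℕ → ℂ, a 0 = a0 → (∀ i ∈ I, a i = 0) → Recursion n a b → a n = a0 * b n

/-- `J` is exponentially `n`-inductive: the same, with `b` vanishing on `J`. -/
def IsExpInductive (n : ℕ) (a0 : ℂ) (J : Set ℕ) : Prop :=
  ∀ a b : ℕ → ℂ, a 0 = a0 → (∀ j ∈ J, b j = 0) → Recursion n a b → a n = a0 * b n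

/-- The indices in `{1, …, n-1}` at which the Taylor coefficient of `f` vanishes. -/
def zeroIndices (n : ℕ) (f : ℂ → ℂ) : Set ℕ := {i | 1 ≤ i ∧ i < n ∧ coeff f i = 0}

/-- The polynomial `P(z) = a_n + 2 a_{n-1} z + … + 2 a_1 z^{n-1} + 2 a_0 z^n`. -/
def P (n : ℕ) (f : ℂ → ℂ) : Polynomial ℂ :=
  Polynomial.C (coeff f n) +
    ∑ k ∈ Finset.Icc 1 n, Polynomial.C (2 * coeff f (n - k)) * Polynomial.X ^ k

/-- `f(z) = exp (∑_j r_j (α_j z + 1)/(α_j z - 1))` in the disk, with `N` distinct points `α_j` of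
the unit circle and `r_j > 0`. -/
def IsAtomicRep (f : ℂ → ℂ) (N : ℕ) (r : Fin N → ℝ) (α : Fin N → ℂ) : Prop :=
  (∀ j, 0 < r j) ∧ (∀ j, ‖α j‖ = 1) ∧ Function.Injective α ∧
    ∀ z ∈ disk, f z = Complex.exp (∑ j, (r j : ℂ) * ((α j * z + 1) / (α j * z - 1)))

/-- The Wiener transform `W_n f (z) = (1/n) ∑_{k=0}^{n-1} f(ω^k z)`, `ω = e^{2πi/n}`. -/
def wiener (n : ℕ) (f : ℂ → ℂ) (z : ℂ) : ℂ :=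
  1 / (n : ℂ) *
    ∑ k ∈ Finset.range n, f (Complex.exp (2 * Real.pi * Complex.I / (n : ℂ)) ^ k * z)

/-- The function `H(z) = ∑_k a_{nk} z^k`, for which `W_n f (z) = H(z^n)`. -/
def wienerH (n : ℕ) (f : ℂ → ℂ) (z : ℂ) : ℂ := ∑' k : ℕ, coeff f (n * k) * z ^ k

/-- `B` is a (finite or infinite) Blaschke product in the disk, times a constant of modulus one:
`B(z) = γ z^m ∏_i (|w_i|/w_i) (w_i - z)/(1 - conj(w_i) z)`, where `0 < |w_i| < 1` and
`∑_i (1 - |w_i|) < ∞`. The index set may be empty. -/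
def IsBlaschke (B : ℂ → ℂ) : Prop :=
  ∃ (γ : ℂ) (m : ℕ) (ι : Type) (w : ι → ℂ),
    ‖γ‖ = 1 ∧ (∀ i, w i ≠ 0 ∧ ‖w i‖ < 1) ∧ Summable (fun i => 1 - ‖w i‖) ∧
    ∀ z ∈ disk, ∃ p : ℂ,
      HasProd (fun i => ((‖w i‖ : ℂ) / w i) *
        ((w i - z) / (1 - (starRingEnd ℂ) (w i) * z))) p ∧
      B z = γ * z ^ m * p

/-- The Riesz factorization `H = B G` of a bounded analytic function in the disk, normalized by
`B(0) > 0`: here `B` is a Blaschke product and `G` is analytic without zeros, with the same supremum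
norm as `H`, which is at most one. For `H(0) > 0` it exists and is unique. -/
def IsRieszFactorization (H B G : ℂ → ℂ) : Prop :=
  IsBlaschke B ∧ (B 0).im = 0 ∧ 0 < (B 0).re ∧
  DifferentiableOn ℂ G disk ∧ (∀ z ∈ disk, G z ≠ 0) ∧
  (∀ z ∈ disk, H z = B z * G z) ∧
  (∀ z ∈ disk, ‖G z‖ ≤ 1) ∧
  sSup ((fun z => ‖G z‖) '' disk) = sSup ((fun z => ‖H z‖) '' disk)

/-- The seventeen conditions (a)–(q) on an extremal function `f = e^g`, in this order. -/
def conditions (n : ℕ) (f g : ℂ → ℂ) : List Prop :=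
  let a : ℕ → ℂ := coeff f
  let b : ℕ → ℂ := coeff g
  [ -- (a)
    a n = 2 * a 0,
    -- (b)
    ∀ k, 1 ≤ k → k < n → a k = 0,
    -- (c)
    EqOn f (krzyzFun n) disk,
    -- (d)
    IsInductive n (a 0) (zeroIndices n f),
    -- (e)
    IsExpInductive n (a 0) (zeroIndices n g),
    -- (f)
    ∃ (H : ℂ → ℂ) (k : ℕ), DifferentiableOn ℂ H disk ∧ (∀ z ∈ disk, ‖H z‖ ≤ 1) ∧ n ≤ 2 * k ∧
      ∀ z ∈ disk, g z = (z ^ k * H z - 1) / (z ^ k * H z + 1),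
    -- (g)
    (-1) ^ n * (P n f).roots.prod = 1,
    -- (h)
    ∀ w ∈ (P n f).roots, ‖w‖ = 1,
    -- (i)
    (P n f).roots = Polynomial.nthRoots n (-1),
    -- (j)
    a n * b 0 + a 0 * ((b n).re : ℂ) = 0,
    -- (k)
    (∑ j ∈ Finset.Ico 1 n, a j * b (n - j)).re = 0,
    -- (l)
    a n = a 0 * ((b n).re : ℂ),
    -- (m)
    (b n).re = 2 * ‖b 0‖ ∧
      ∃ (N : ℕ) (r : Fin N → ℝ) (α : Fin N → ℂ),
        IsAtomicRep f N r α ∧ N = n ∧ ∀ i j, r i = r j,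
    -- (n)
    ∃ B G : ℂ → ℂ, IsRieszFactorization (wienerH n f) B G ∧ B 0 = 1,
    -- (o)
    ∀ z ∈ disk, wiener n f z ≠ 0,
    -- (p)
    EqOn (wiener n f) f disk,
    -- (q)
    EqOn g (wiener n g) disk ]

end Krzyz

end

/-!
# Equivalent conditions for the Krzyż conjecture

Let `f = e^g` be extremal, with `a_0 = e^{-t}` and `b_0 = -t`. Rotations of the disk and of the
values show that `a_n = |a_n|`, and comparison with `krzyzFun n = exp ((z^n - 1)/(z^n + 1))` gives
`a_n ≥ 2/e`. The first variation along `f e^{sG}` (`IsExtremal.variation`) gives `Re {f G}_n ≤ 0`.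
With `G = ±g` this becomes `Re {f g}_n = 0` (`IsExtremal.re_sum_Ico`), which links the conditions on
`a_n b_0 + a_0 Re b_n` and on `∑ a_j b_{n-j}`. With `G = (αz + 1)/(αz - 1)`, `|α| = 1`, it says that
`Re P ≥ 0` on the unit circle (`IsExtremal.re_trig_nonneg`).

The mean of `Re P` over the `n`-th roots of `-1` is `a_n - 2a_0`, so `a_n ≥ 2a_0`. In case of
equality `Re P` has double zeros at these `n` points, which forces `a_k = 0` for `1 ≤ k < n`
(`IsExtremal.coeff_eq_zero`). If these coefficients vanish, then `b_0 = -1` and `b_n = 2`, and the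
equality case of Schwarz's lemma for the Cayley transform of `g` gives `f = krzyzFun n`
(`IsExtremal.eqOn_krzyzFun`). That function satisfies all the conditions.

It remains to reach `a_n = 2a_0`, or the vanishing of the intermediate coefficients, from each
condition. Several conditions yield `a_n ≤ 2te^{-t}` with `e^{-t} = a_0`, by Carathéodory's bound
`|b_k| ≤ 2|b_0|` (`norm_coeff_le_two_mul`) for `g` itself or for a logarithm of the function `H_f`
of the Wiener transform. As `2te^{-t} ≤ 2/e ≤ a_n`, with equality in the first only for `t = 1`,
this gives `a_n = 2a_0` (`IsExtremal.coeff_eq_of_le`). When `g = (φ - 1)/(φ + 1)` with `φ = O(z^k)`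
and `2k ≥ n`, the absence of a quadratic term in `exp ((w - 1)/(w + 1)) = e⁻¹(1 + 2w + O(w³))` gives
`a_n = 2e⁻¹ {φ}_n`. For the zeros of `P`, Vieta's formula reads
`a_n = 2a_0 (-1)^n ∏ λ_k`.

For the uniqueness statement, an extremal function exists because the coefficient sequences of the
admissible logarithms with bounded `b_0` form a compact set, and `a_n` is small for large `|b_0|`
(`exists_isExtremal`). If it is unique, it is invariant under the rotation by `e^{2πi/n}`, so
`a_k = 0` for `1 ≤ k < n`.
-/

namespace Krzyz

open Filter Topology

/-! ### Taylor coefficients of functions analytic in the disk -/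

lemma mem_disk {z : ℂ} : z ∈ disk ↔ ‖z‖ < 1 := by simp [disk]

lemma zero_mem_disk : (0 : ℂ) ∈ disk := by simp [disk]

lemma isOpen_disk : IsOpen disk := isOpen_ball

lemma disk_mem_nhds : disk ∈ 𝓝 (0 : ℂ) := isOpen_disk.mem_nhds zero_mem_disk

lemma pow_mem_disk {z : ℂ} (hz : z ∈ disk) {n : ℕ} (hn : n ≠ 0) : z ^ n ∈ disk := by
  rw [mem_disk] at *
  rw [norm_pow]
  exact pow_lt_one₀ (norm_nonneg _) hz hn

lemma mul_mem_disk {c z : ℂ} (hc : ‖c‖ ≤ 1) (hz : z ∈ disk) : c * z ∈ disk := by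
  rw [mem_disk] at *
  rw [norm_mul]
  exact (mul_le_of_le_one_left (norm_nonneg _) hc).trans_lt hz

lemma coeff_congr {f g : ℂ → ℂ} (h : EqOn f g disk) (k : ℕ) : coeff f k = coeff g k := by
  unfold coeff
  rw [(h.eventuallyEq_of_mem disk_mem_nhds).iteratedDeriv_eq]

lemma coeff_zero (f : ℂ → ℂ) : coeff f 0 = f 0 := by simp [coeff]

lemma hasSum_coeff {f : ℂ → ℂ} (hf : DifferentiableOn ℂ f disk) {z : ℂ} (hz : z ∈ disk) :
    HasSum (fun k => coeff f k * z ^ k) (f z) := by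
  convert! Complex.hasSum_taylorSeries_on_ball hf hz using 2 with k
  simp only [coeff, sub_zero, smul_eq_mul]
  ring

lemma hasFPowerSeriesOnBall_of_hasSum {f : ℂ → ℂ} {c : ℕ → ℂ}
    (h : ∀ z ∈ disk, HasSum (fun k => c k * z ^ k) (f z)) :
    HasFPowerSeriesOnBall f (FormalMultilinearSeries.ofScalars ℂ c) 0 1 where
  r_le := by
    refine ENNReal.le_of_forall_nnreal_lt fun r hr => ?_
    have hr : (r : ℝ) < 1 := by exact_mod_cast hr
    refine FormalMultilinearSeries.le_radius_of_tendsto _ (l := 0) ?_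
    have := (h (r : ℝ) (by simpa [mem_disk] using hr)).summable.tendsto_atTop_zero.norm
    simpa using this
  r_pos := one_pos
  hasSum := by
    intro y hy
    have hy : y ∈ disk := by simpa [mem_disk, enorm_eq_nnnorm, ← NNReal.coe_lt_coe] using hy
    have := h y hy
    simpa [mul_comm] using this

lemma coeff_eq_of_hasSum {f : ℂ → ℂ} {c : ℕ → ℂ}
    (h : ∀ z ∈ disk, HasSum (fun k => c k * z ^ k) (f z)) (k : ℕ) : coeff f k = c k := by
  have h1 := (hasFPowerSeriesOnBall_of_hasSum h).hasFPowerSeriesAt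
  have h2 := h1.analyticAt.hasFPowerSeriesAt
  have := congrArg (fun p => FormalMultilinearSeries.coeff p k) (h1.eq_formalMultilinearSeries h2)
  simpa [coeff] using this.symm

lemma differentiableOn_of_hasSum {f : ℂ → ℂ} {c : ℕ → ℂ}
    (h : ∀ z ∈ disk, HasSum (fun k => c k * z ^ k) (f z)) : DifferentiableOn ℂ f disk := by
  refine (hasFPowerSeriesOnBall_of_hasSum h).differentiableOn.mono fun z hz => ?_
  simpa [mem_disk, enorm_eq_nnnorm, ← NNReal.coe_lt_coe] using hz

lemma coeff_add {f g : ℂ → ℂ} (hf : DifferentiableOn ℂ f disk)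
    (hg : DifferentiableOn ℂ g disk) (k : ℕ) :
    coeff (fun z => f z + g z) k = coeff f k + coeff g k :=
  coeff_eq_of_hasSum (c := fun k => coeff f k + coeff g k) (fun z hz => by
    simpa [add_mul] using (hasSum_coeff hf hz).add (hasSum_coeff hg hz)) k

lemma coeff_sub {f g : ℂ → ℂ} (hf : DifferentiableOn ℂ f disk)
    (hg : DifferentiableOn ℂ g disk) (k : ℕ) :
    coeff (fun z => f z - g z) k = coeff f k - coeff g k :=
  coeff_eq_of_hasSum (c := fun k => coeff f k - coeff g k) (fun z hz => by
    simpa [sub_mul] using (hasSum_coeff hf hz).sub (hasSum_coeff hg hz)) k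

lemma coeff_const_mul (c : ℂ) {f : ℂ → ℂ} (hf : DifferentiableOn ℂ f disk) (k : ℕ) :
    coeff (fun z => c * f z) k = c * coeff f k :=
  coeff_eq_of_hasSum (c := fun k => c * coeff f k) (fun z hz => by
    simpa [mul_assoc] using (hasSum_coeff hf hz).mul_left c) k

lemma coeff_const (c : ℂ) (k : ℕ) : coeff (fun _ => c) k = if k = 0 then c else 0 := by
  unfold coeff
  rw [iteratedDeriv_const]
  split_ifs with h <;> simp [h]

lemma coeff_pow (m k : ℕ) : coeff (fun z => z ^ m) k = if k = m then 1 else 0 := by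
  unfold coeff
  rw [iteratedDeriv_fun_pow_zero]
  split_ifs with h
  · rw [h, div_self (by exact_mod_cast Nat.factorial_ne_zero m)]
  · simp

lemma coeff_mul {f g : ℂ → ℂ} (hf : DifferentiableOn ℂ f disk)
    (hg : DifferentiableOn ℂ g disk) (n : ℕ) :
    coeff (fun z => f z * g z) n = ∑ k ∈ Finset.range (n + 1), coeff f k * coeff g (n - k) := by
  refine coeff_eq_of_hasSum
    (c := fun n => ∑ k ∈ Finset.range (n + 1), coeff f k * coeff g (n - k)) (fun z hz => ?_) n
  have h1 := hasSum_coeff hf hz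
  have h2 := hasSum_coeff hg hz
  have := hasSum_sum_range_mul_of_summable_norm h1.summable.norm h2.summable.norm
  rw [h1.tsum_eq, h2.tsum_eq] at this
  convert! this using 2 with m
  rw [Finset.sum_mul]
  refine Finset.sum_congr rfl fun k hk => ?_
  have : m = k + (m - k) := by have := Finset.mem_range.1 hk; omega
  conv_lhs => rw [show z ^ m = z ^ k * z ^ (m - k) by rw [← pow_add, ← this]]
  ring

lemma coeff_pow_mul (m : ℕ) {f : ℂ → ℂ} (hf : DifferentiableOn ℂ f disk) (n : ℕ) :
    coeff (fun z => z ^ m * f z) n = if m ≤ n then coeff f (n - m) else 0 := by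
  rw [coeff_mul (by fun_prop) hf]
  simp only [coeff_pow, ite_mul, one_mul, zero_mul, Finset.sum_ite_eq', Finset.mem_range]
  simp only [Nat.lt_succ_iff]

lemma coeff_deriv (f : ℂ → ℂ) (k : ℕ) : coeff (deriv f) k = (k + 1) * coeff f (k + 1) := by
  unfold coeff
  rw [iteratedDeriv_succ', Nat.factorial_succ]
  have : (Nat.factorial k : ℂ) ≠ 0 := by exact_mod_cast Nat.factorial_ne_zero k
  have : (k + 1 : ℂ) ≠ 0 := by exact_mod_cast Nat.succ_ne_zero k
  push_cast
  field_simp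

lemma coeff_comp_mul {c : ℂ} (hc : ‖c‖ ≤ 1) {f : ℂ → ℂ} (hf : DifferentiableOn ℂ f disk)
    (k : ℕ) : coeff (fun z => f (c * z)) k = c ^ k * coeff f k :=
  coeff_eq_of_hasSum (c := fun k => c ^ k * coeff f k) (fun z hz => by
    have := hasSum_coeff hf (mul_mem_disk hc hz)
    convert this using 2 with j
    ring) k

lemma differentiableOn_comp_mul {c : ℂ} (hc : ‖c‖ ≤ 1) {f : ℂ → ℂ}
    (hf : DifferentiableOn ℂ f disk) : DifferentiableOn ℂ (fun z => f (c * z)) disk :=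
  hf.comp (by fun_prop) fun _ hz => mul_mem_disk hc hz

/-- Cauchy's estimate on a smaller disk. -/
lemma norm_coeff_le_div_pow {f : ℂ → ℂ} (hf : DifferentiableOn ℂ f disk) {r C : ℝ} (h0 : 0 < r)
    (h1 : r < 1) (hC : ∀ z, ‖z‖ ≤ r → ‖f z‖ ≤ C) (k : ℕ) : ‖coeff f k‖ ≤ C / r ^ k := by
  have hsub : closedBall (0 : ℂ) r ⊆ disk := closedBall_subset_ball h1
  have hd : DiffContOnCl ℂ f (ball 0 r) :=
    (hf.mono hsub).diffContOnCl_ball Subset.rfl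
  have := Complex.norm_iteratedDeriv_le_of_forall_mem_sphere_norm_le k h0 hd
    (fun z hz => hC z (by simpa using (mem_sphere_zero_iff_norm.1 hz).le))
  unfold coeff
  rw [norm_div, Complex.norm_natCast, div_le_iff₀ (by positivity)]
  calc _ ≤ _ := this
    _ = _ := by ring

/-- Cauchy's estimate, in the limit `r → 1`. -/
lemma norm_coeff_le {f : ℂ → ℂ} (hf : DifferentiableOn ℂ f disk) {C : ℝ}
    (hC : ∀ z ∈ disk, ‖f z‖ ≤ C) (k : ℕ) : ‖coeff f k‖ ≤ C := by
  have h1 : Tendsto (fun r : ℝ => C / r ^ k) (𝓝[<] 1) (𝓝 (C / 1 ^ k)) := by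
    refine ContinuousAt.tendsto (f := fun r : ℝ => C / r ^ k) ?_ |>.mono_left nhdsWithin_le_nhds
    fun_prop (disch := simp)
  rw [one_pow, div_one] at h1
  refine ge_of_tendsto h1 ?_
  filter_upwards [Ioo_mem_nhdsLT (zero_lt_one' ℝ)] with r hr
  exact norm_coeff_le_div_pow hf hr.1 hr.2
    (fun z hz => hC z (mem_disk.2 (hz.trans_lt hr.2))) k

/-- The relation `f' = g' f` for `f = e^g`, in terms of Taylor coefficients. -/
lemma recursion_of_exp {f g : ℂ → ℂ} (hg : DifferentiableOn ℂ g disk)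
    (h : ∀ z ∈ disk, f z = Complex.exp (g z)) (n : ℕ) : Recursion n (coeff f) (coeff g) := by
  intro m hm _
  have hf : DifferentiableOn ℂ f disk := hg.cexp.congr h
  obtain ⟨m, rfl⟩ : ∃ k, m = k + 1 := ⟨m - 1, by omega⟩
  have hd : EqOn (deriv f) (fun z => deriv g z * f z) disk := by
    intro z hz
    have h1 : f =ᶠ[𝓝 z] fun z => Complex.exp (g z) :=
      EqOn.eventuallyEq_of_mem h (isOpen_disk.mem_nhds hz)
    have h2 := (hg.differentiableAt (isOpen_disk.mem_nhds hz)).hasDerivAt.cexp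
    simp only [h1.deriv_eq, h2.deriv, h z hz]
    ring
  have h3 := coeff_congr hd m
  rw [coeff_deriv, coeff_mul (hg.deriv isOpen_disk) hf] at h3
  have : (m + 1 : ℂ) ≠ 0 := by exact_mod_cast Nat.succ_ne_zero m
  rw [← mul_right_inj' this, h3, Finset.mul_sum]
  rw [← Finset.Ico_succ_right_eq_Icc, Order.succ_eq_add_one, ← zero_add 1, ← Finset.sum_Ico_add',
    ← Finset.range_eq_Ico]
  refine Finset.sum_congr rfl fun k hk => ?_
  rw [coeff_deriv, zero_add, show m + 1 - (k + 1) = m - k by omega]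
  push_cast
  field_simp

/-! ### Averages over roots of unity -/

/-- The primitive root of unity `e^{2πi/n}` used in the Wiener transform. -/
noncomputable def rootUnity (n : ℕ) : ℂ := Complex.exp (2 * Real.pi * Complex.I / (n : ℂ))

lemma isPrimitiveRoot_rootUnity {n : ℕ} (hn : n ≠ 0) : IsPrimitiveRoot (rootUnity n) n :=
  Complex.isPrimitiveRoot_exp n hn

lemma norm_rootUnity {n : ℕ} (hn : n ≠ 0) : ‖rootUnity n‖ = 1 :=
  (isPrimitiveRoot_rootUnity hn).norm'_eq_one hn

lemma norm_rootUnity_pow {n : ℕ} (hn : n ≠ 0) (j : ℕ) : ‖rootUnity n ^ j‖ = 1 := by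
  rw [norm_pow, norm_rootUnity hn, one_pow]

lemma rootUnity_pow_pow {n : ℕ} (hn : n ≠ 0) (j : ℕ) : (rootUnity n ^ j) ^ n = 1 := by
  rw [← pow_mul, mul_comm, pow_mul, (isPrimitiveRoot_rootUnity hn).pow_eq_one, one_pow]

lemma sum_rootUnity_pow {n : ℕ} (hn : n ≠ 0) (k : ℕ) :
    ∑ j ∈ Finset.range n, (rootUnity n ^ j) ^ k = if n ∣ k then (n : ℂ) else 0 := by
  have hp := isPrimitiveRoot_rootUnity hn
  simp only [← pow_mul, mul_comm _ k]
  simp only [pow_mul]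
  split_ifs with h
  · rw [(hp.pow_eq_one_iff_dvd k).2 h]
    simp
  · have h1 : rootUnity n ^ k - 1 ≠ 0 := sub_ne_zero.2 fun h' => h ((hp.pow_eq_one_iff_dvd k).1 h')
    have h2 := mul_geom_sum (rootUnity n ^ k) n
    rw [rootUnity_pow_pow hn, sub_self] at h2
    exact (mul_eq_zero.1 h2).resolve_left h1

lemma wiener_eq (n : ℕ) (f : ℂ → ℂ) (z : ℂ) :
    wiener n f z = 1 / (n : ℂ) * ∑ k ∈ Finset.range n, f (rootUnity n ^ k * z) := rfl

lemma hasSum_wiener {n : ℕ} (hn : n ≠ 0) {f : ℂ → ℂ} (hf : DifferentiableOn ℂ f disk) {z : ℂ}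
    (hz : z ∈ disk) :
    HasSum (fun k => (if n ∣ k then coeff f k else 0) * z ^ k) (wiener n f z) := by
  have h := (hasSum_sum fun j (_ : j ∈ Finset.range n) =>
    hasSum_coeff hf (mul_mem_disk (norm_rootUnity_pow hn j).le hz)).mul_left (1 / (n : ℂ))
  rw [wiener_eq]
  have hn' : (n : ℂ) ≠ 0 := by exact_mod_cast hn
  convert! h using 2 with k
  simp only [mul_pow, mul_left_comm _ (_ ^ k) (_ ^ k), ← Finset.sum_mul]
  rw [sum_rootUnity_pow hn k]
  split_ifs <;> simp
  field_simp

lemma coeff_wiener {n : ℕ} (hn : n ≠ 0) {f : ℂ → ℂ} (hf : DifferentiableOn ℂ f disk) (k : ℕ) :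
    coeff (wiener n f) k = if n ∣ k then coeff f k else 0 :=
  coeff_eq_of_hasSum (c := fun k => if n ∣ k then coeff f k else 0)
    (fun _ hz => hasSum_wiener hn hf hz) k

lemma differentiableOn_wiener {n : ℕ} (hn : n ≠ 0) {f : ℂ → ℂ} (hf : DifferentiableOn ℂ f disk) :
    DifferentiableOn ℂ (wiener n f) disk :=
  differentiableOn_of_hasSum fun _ hz => hasSum_wiener hn hf hz

lemma re_wiener_nonpos {n : ℕ} (hn : n ≠ 0) {f : ℂ → ℂ} (hf : ∀ z ∈ disk, (f z).re ≤ 0) {z : ℂ}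
    (hz : z ∈ disk) : (wiener n f z).re ≤ 0 := by
  have : (1 / (n : ℂ)) = ((1 / n : ℝ) : ℂ) := by push_cast; rfl
  rw [wiener_eq, this, Complex.re_ofReal_mul, Complex.re_sum]
  exact mul_nonpos_of_nonneg_of_nonpos (by positivity)
    (Finset.sum_nonpos fun j _ => hf _ (mul_mem_disk (norm_rootUnity_pow hn j).le hz))

lemma norm_wiener_le_one {n : ℕ} (hn : n ≠ 0) {f : ℂ → ℂ} (hf : ∀ z ∈ disk, ‖f z‖ ≤ 1) {z : ℂ}
    (hz : z ∈ disk) : ‖wiener n f z‖ ≤ 1 := by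
  rw [wiener_eq, norm_mul, norm_div, norm_one, Complex.norm_natCast, one_div,
    inv_mul_le_iff₀ (by positivity), mul_one]
  refine (norm_sum_le _ _).trans ?_
  refine (Finset.sum_le_sum fun j _ => hf _ (mul_mem_disk (norm_rootUnity_pow hn j).le hz)).trans ?_
  simp

lemma hasSum_wienerH (n : ℕ) {f : ℂ → ℂ} (hf : DifferentiableOn ℂ f disk)
    (hb : ∀ z ∈ disk, ‖f z‖ ≤ 1) {z : ℂ} (hz : z ∈ disk) :
    HasSum (fun k => coeff f (n * k) * z ^ k) (wienerH n f z) := by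
  refine Summable.hasSum ?_
  refine Summable.of_norm_bounded (g := fun k => ‖z‖ ^ k)
    (summable_geometric_of_lt_one (norm_nonneg _) (mem_disk.1 hz)) fun k => ?_
  rw [norm_mul, norm_pow]
  exact mul_le_of_le_one_left (by positivity) (norm_coeff_le hf hb _)

lemma wienerH_pow {n : ℕ} (hn : n ≠ 0) {f : ℂ → ℂ} (hf : DifferentiableOn ℂ f disk)
    (hb : ∀ z ∈ disk, ‖f z‖ ≤ 1) {z : ℂ} (hz : z ∈ disk) :
    wienerH n f (z ^ n) = wiener n f z := by
  have h1 := hasSum_wienerH n hf hb (pow_mem_disk hz hn)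
  have h2 := hasSum_wiener hn hf hz
  refine h1.unique ?_
  have hinj : Function.Injective fun k : ℕ => n * k := fun a b h =>
    Nat.eq_of_mul_eq_mul_left (Nat.pos_of_ne_zero hn) h
  rw [← hinj.hasSum_iff] at h2
  · convert! h2 using 2 with k
    simp [pow_mul]
  · intro k hk
    rw [if_neg, zero_mul]
    rintro ⟨j, rfl⟩
    exact hk ⟨j, rfl⟩

lemma exists_pow_eq_mem_disk {n : ℕ} (hn : n ≠ 0) {z : ℂ} (hz : z ∈ disk) :
    ∃ w ∈ disk, w ^ n = z := by
  obtain ⟨w, hw⟩ := IsAlgClosed.exists_pow_nat_eq z (Nat.pos_of_ne_zero hn)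
  refine ⟨w, ?_, hw⟩
  rw [mem_disk] at *
  rw [← hw, norm_pow] at hz
  exact (pow_lt_one_iff_of_nonneg (norm_nonneg _) hn).1 hz

/-! ### Functions with nonpositive real part -/

lemma norm_add_le_norm_sub {t : ℝ} (ht : 0 ≤ t) {w : ℂ} (hw : w.re ≤ 0) :
    ‖(t : ℂ) + w‖ ≤ ‖(t : ℂ) - w‖ := by
  rw [← sq_le_sq₀ (norm_nonneg _) (norm_nonneg _), ← Complex.normSq_eq_norm_sq,
    ← Complex.normSq_eq_norm_sq, Complex.normSq_apply, Complex.normSq_apply]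
  simp
  nlinarith

lemma ofReal_sub_ne_zero {t : ℝ} (ht : 0 < t) {w : ℂ} (hw : w.re ≤ 0) : (t : ℂ) - w ≠ 0 := by
  intro h
  have := congrArg Complex.re h
  simp at this
  linarith

lemma differentiableOn_cayley {t : ℝ} (ht : 0 < t) {g : ℂ → ℂ} (hg : DifferentiableOn ℂ g disk)
    (hre : ∀ z ∈ disk, (g z).re ≤ 0) :
    DifferentiableOn ℂ (fun z => (t + g z) / (t - g z)) disk :=
  (hg.const_add _).div (hg.const_sub _) fun z hz => ofReal_sub_ne_zero ht (hre z hz)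

lemma norm_cayley_le_one {t : ℝ} (ht : 0 < t) {w : ℂ} (hw : w.re ≤ 0) :
    ‖((t : ℂ) + w) / (t - w)‖ ≤ 1 := by
  rw [norm_div]
  exact div_le_one_of_le₀ (norm_add_le_norm_sub ht.le hw) (norm_nonneg _)

/-- If `g = -t + O(z^n)` has nonpositive real part, its Cayley transform `(t + g)/(t - g)` is
`b_n/(2t) z^n + O(z^{n+1})`. -/
lemma coeff_cayley {t : ℝ} (ht : 0 < t) {g : ℂ → ℂ} (hg : DifferentiableOn ℂ g disk)
    (hre : ∀ z ∈ disk, (g z).re ≤ 0) (h0 : coeff g 0 = -t) {n : ℕ} (hn : n ≠ 0)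
    (hk : ∀ k, 1 ≤ k → k < n → coeff g k = 0) {k : ℕ} (hkn : k ≤ n) :
    coeff (fun z => (t + g z) / (t - g z)) k = if k = n then coeff g n / (2 * t) else 0 := by
  set φ : ℂ → ℂ := fun z => (t + g z) / (t - g z) with hφ
  have hφd : DifferentiableOn ℂ φ disk := differentiableOn_cayley ht hg hre
  have heq : EqOn (fun z => 2 * t * φ z) (fun z => (1 + φ z) * (t + g z)) disk := by
    intro z hz
    have := ofReal_sub_ne_zero ht (hre z hz)
    simp only [hφ]
    field_simp
    ring
  have hT : (t : ℂ) ≠ 0 := by exact_mod_cast ht.ne'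
  have hs : ∀ j, j < n → coeff (fun z => (t : ℂ) + g z) j = 0 := by
    intro j hj
    rw [coeff_add (by fun_prop) hg, coeff_const]
    rcases Nat.eq_zero_or_pos j with rfl | h
    · simp [h0]
    · simp [h.ne', hk j h hj]
  have hsn : coeff (fun z => (t : ℂ) + g z) n = coeff g n := by
    rw [coeff_add (by fun_prop) hg, coeff_const]
    simp [hn]
  have h1 : ∀ j, coeff (fun z => 2 * t * φ z) j = 2 * t * coeff φ j :=
    coeff_const_mul _ hφd
  have h2 := coeff_congr heq k
  rw [h1, coeff_mul (by fun_prop) (by fun_prop), Finset.sum_range_succ'] at h2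
  have hrest : ∑ j ∈ Finset.range k, coeff (fun z => 1 + φ z) (j + 1) *
      coeff (fun z => (t : ℂ) + g z) (k - (j + 1)) = 0 := by
    refine Finset.sum_eq_zero fun j hj => ?_
    rw [hs _ (by have := Finset.mem_range.1 hj; omega), mul_zero]
  have hφ0 : φ 0 = 0 := by
    rw [coeff_zero] at h0
    simp [hφ, h0]
  rw [hrest, zero_add, coeff_zero, hφ0, add_zero, one_mul, Nat.sub_zero] at h2
  split_ifs with h
  · subst h
    rw [hsn] at h2
    rw [← h2]
    field_simp
  · rw [hs k (by omega)] at h2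
    simpa [hT] using h2

/-- Carathéodory's coefficient bound. The average of `g` over the `k`-th roots of unity is
`b_0 + b_k z^k + O(z^{k+1})`, and Cauchy's estimate applies to its Cayley transform. -/
theorem norm_coeff_le_two_mul {g : ℂ → ℂ} (hg : DifferentiableOn ℂ g disk)
    (hre : ∀ z ∈ disk, (g z).re ≤ 0) {t : ℝ} (h0 : coeff g 0 = -t) {k : ℕ} (hk : k ≠ 0) :
    ‖coeff g k‖ ≤ 2 * t := by
  have ht : 0 ≤ t := by
    have := hre 0 zero_mem_disk
    rw [← coeff_zero g, h0] at this
    simpa using this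
  -- Subtracting `ε` makes `g(0)` strictly negative.
  refine le_of_forall_pos_le_add fun ε hε => ?_
  set h : ℂ → ℂ := wiener k (fun z => g z - (ε / 2 : ℝ)) with hh
  have hd : DifferentiableOn ℂ (fun z => g z - (ε / 2 : ℝ)) disk := by fun_prop
  have hhd : DifferentiableOn ℂ h disk := differentiableOn_wiener hk hd
  have hhre : ∀ z ∈ disk, (h z).re ≤ 0 := fun z hz =>
    re_wiener_nonpos hk (fun z hz => by simpa using by linarith [hre z hz]) hz
  have hc : ∀ j, coeff (fun z => g z - (ε / 2 : ℝ)) j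
      = coeff g j - if j = 0 then ((ε / 2 : ℝ) : ℂ) else 0 := fun j => by
    rw [coeff_sub hg (by fun_prop), coeff_const]
  have h1 := coeff_cayley (t := t + ε / 2) (by positivity) hhd hhre (n := k)
    (by rw [hh, coeff_wiener hk hd, hc, h0]; simp; ring) hk
    (fun j hj1 hj2 => by
      rw [hh, coeff_wiener hk hd, if_neg (Nat.not_dvd_of_pos_of_lt hj1 hj2)]) le_rfl
  have h2 := norm_coeff_le (differentiableOn_cayley (t := t + ε / 2) (by positivity) hhd hhre)
    (fun z hz => norm_cayley_le_one (by positivity) (hhre z hz)) k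
  rw [h1, if_pos rfl, hh, coeff_wiener hk hd, if_pos dvd_rfl, hc, if_neg hk, sub_zero, norm_div,
    norm_mul, Complex.norm_real, Real.norm_of_nonneg (by positivity),
    div_le_one (by simp; positivity)] at h2
  simp at h2
  linarith

lemma eqOn_const_of_norm_eq_one {φ : ℂ → ℂ} (hd : DifferentiableOn ℂ φ disk)
    (hb : ∀ z ∈ disk, ‖φ z‖ ≤ 1) {z₀ : ℂ} (hz₀ : z₀ ∈ disk) (h : ‖φ z₀‖ = 1) :
    EqOn φ (fun _ => φ z₀) disk :=
  Complex.eqOn_of_isPreconnected_of_isMaxOn_norm (convex_ball 0 1).isPreconnected isOpen_disk hd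
    hz₀ fun z hz => by simpa [h] using hb z hz

/-- The equality case of Schwarz's lemma at a zero of order `n`. -/
lemma eqOn_pow_of_coeff_eq_one {n : ℕ} : ∀ {φ : ℂ → ℂ}, DifferentiableOn ℂ φ disk →
    (∀ z ∈ disk, ‖φ z‖ ≤ 1) → (∀ k < n, coeff φ k = 0) → coeff φ n = 1 →
    EqOn φ (fun z => z ^ n) disk := by
  induction n with
  | zero =>
    intro φ hd hb _ h1
    rw [coeff_zero] at h1
    simpa [h1] using eqOn_const_of_norm_eq_one hd hb zero_mem_disk (by simp [h1])
  | succ n ih =>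
    intro φ hd hb h0 h1
    have hφ0 : φ 0 = 0 := by rw [← coeff_zero φ]; exact h0 0 n.succ_pos
    have hψd : DifferentiableOn ℂ (dslope φ 0) disk :=
      (Complex.differentiableOn_dslope disk_mem_nhds).2 hd
    have hmul : ∀ z, φ z = z ^ 1 * dslope φ 0 z := fun z => by
      have := sub_smul_dslope φ 0 z
      simpa [hφ0] using this.symm
    have hψb : ∀ z ∈ disk, ‖dslope φ 0 z‖ ≤ 1 := fun z hz => by
      have := Complex.norm_dslope_le_div_of_mapsTo_ball (f := φ) (c := 0) (R₁ := 1) (R₂ := 1) hd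
        (fun z hz => by simpa [hφ0] using hb z hz) hz
      simpa using this
    have hc : ∀ k, coeff φ (k + 1) = coeff (dslope φ 0) k := fun k => by
      rw [coeff_congr (fun z _ => hmul z) (k + 1), coeff_pow_mul 1 hψd]
      simp
    have := ih hψd hψb (fun k hk => by rw [← hc]; exact h0 _ (by omega)) (by rw [← hc]; exact h1)
    intro z hz
    rw [hmul, this hz]
    ring

/-! ### Logarithms -/

lemma BStar.re_le {f g : ℂ → ℂ} (hf : BStar f) (h : ∀ z ∈ disk, f z = Complex.exp (g z)) :
    ∀ z ∈ disk, (g z).re ≤ 0 := by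
  intro z hz
  have := (hf.2 z hz).2
  rw [h z hz, Complex.norm_exp] at this
  simpa using this

/-- A zero-free analytic function with `f(0) > 0` has an analytic logarithm that is real at the
origin. -/
lemma Normalized.exists_log {f : ℂ → ℂ} (hf : Normalized f) :
    ∃ g : ℂ → ℂ, DifferentiableOn ℂ g disk ∧ (∀ z ∈ disk, f z = Complex.exp (g z)) ∧
      ∃ t : ℝ, coeff g 0 = -t := by
  have hne : ∀ z ∈ disk, f z ≠ 0 := fun z hz => norm_pos_iff.1 (hf.1.2 z hz).1
  have hd := hf.1.1
  have hq : DifferentiableOn ℂ (fun z => deriv f z / f z) (ball 0 1) :=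
    (hd.deriv isOpen_disk).div hd hne
  obtain ⟨g, hg0, hg⟩ := hq.isExactOn_ball.with_val_at 0 (Complex.log (f 0))
  have hgd : DifferentiableOn ℂ g disk := fun z hz =>
    (hg z hz).differentiableAt.differentiableWithinAt
  have hconst : ∀ z ∈ disk, f z * Complex.exp (-g z) = f 0 * Complex.exp (-g 0) := by
    intro z hz
    refine isOpen_disk.is_const_of_deriv_eq_zero (convex_ball (0 : ℂ) 1).isPreconnected
      (f := fun z => f z * Complex.exp (-g z)) ?_ ?_ hz zero_mem_disk
    · exact hd.mul hgd.neg.cexp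
    · intro w hw
      have h1 := (hd.differentiableAt (isOpen_disk.mem_nhds hw)).hasDerivAt
      have h2 := h1.mul (hg w hw).fun_neg.cexp
      have h3 := hne w hw
      refine h2.deriv.trans ?_
      simp only [Pi.zero_apply]
      field_simp
      ring
  refine ⟨g, hgd, fun z hz => ?_, -Real.log (f 0).re, ?_⟩
  · have h1 := hconst z hz
    rw [hg0, Complex.exp_neg, Complex.exp_neg, Complex.exp_log (hne 0 zero_mem_disk),
      mul_inv_cancel₀ (hne 0 zero_mem_disk)] at h1
    field_simp at h1
    exact h1
  · obtain ⟨him, hre⟩ := hf.2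
    rw [coeff_zero] at *
    have : f 0 = ((f 0).re : ℂ) := Complex.ext (by simp) (by simpa using him)
    rw [hg0, Complex.ofReal_neg, neg_neg, Complex.ofReal_log hre.le, ← this]

/-- Two analytic logarithms that agree at the origin agree. -/
lemma eqOn_of_exp_eq {g h : ℂ → ℂ} (hg : DifferentiableOn ℂ g disk)
    (hh : DifferentiableOn ℂ h disk) (he : ∀ z ∈ disk, Complex.exp (g z) = Complex.exp (h z))
    (h0 : g 0 = h 0) : EqOn g h disk := by
  have hd : ∀ z ∈ disk, deriv (fun z => g z - h z) z = 0 := by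
    intro z hz
    have h1 := (hg.differentiableAt (isOpen_disk.mem_nhds hz)).hasDerivAt
    have h2 := (hh.differentiableAt (isOpen_disk.mem_nhds hz)).hasDerivAt
    have h3 : (fun z => Complex.exp (g z - h z)) =ᶠ[𝓝 z] fun _ => 1 := by
      filter_upwards [isOpen_disk.mem_nhds hz] with w hw
      rw [Complex.exp_sub, he w hw, div_self (Complex.exp_ne_zero _)]
    have h4 := (h1.fun_sub h2).cexp.deriv
    rw [h3.deriv_eq, deriv_const] at h4
    rw [(h1.fun_sub h2).deriv]
    exact (mul_eq_zero.1 h4.symm).resolve_left (Complex.exp_ne_zero _)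
  intro z hz
  have := isOpen_disk.is_const_of_deriv_eq_zero (convex_ball (0 : ℂ) 1).isPreconnected
    (f := fun z => g z - h z) (hg.sub hh) hd hz zero_mem_disk
  simpa [h0, sub_eq_zero] using this

/-! ### The function `exp ((w - 1) / (w + 1))` -/

lemma re_sub_one_div_add_one_nonpos {w : ℂ} (hw : ‖w‖ ≤ 1) : ((w - 1) / (w + 1)).re ≤ 0 := by
  have h : Complex.normSq w ≤ 1 := by
    rw [Complex.normSq_eq_norm_sq]
    exact pow_le_one₀ (norm_nonneg _) hw
  rw [Complex.normSq_apply] at h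
  rw [Complex.div_re, ← add_div]
  refine div_nonpos_of_nonpos_of_nonneg ?_ (Complex.normSq_nonneg _)
  simp
  nlinarith

lemma add_one_ne_zero_of_mem_disk {w : ℂ} (hw : w ∈ disk) : w + 1 ≠ 0 := by
  intro h
  rw [mem_disk, eq_neg_of_add_eq_zero_left h] at hw
  simp at hw

lemma one_sub_ne_zero_of_mem_disk {w : ℂ} (hw : w ∈ disk) : 1 - w ≠ 0 := by
  intro h
  rw [mem_disk, ← sub_eq_zero.1 h] at hw
  simp at hw

/-- `(w + 1)/(w - 1) = -(1 + 2 ∑_{k ≥ 1} w^k)`. -/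
lemma hasSum_add_one_div_sub_one {w : ℂ} (hw : w ∈ disk) :
    HasSum (fun k : ℕ => (if k = 0 then -1 else -2) * w ^ k) ((w + 1) / (w - 1)) := by
  have h1 := (hasSum_geometric_of_norm_lt_one (mem_disk.1 hw)).mul_left (-2)
  have h2 : HasSum (fun k : ℕ => if k = 0 then (1 : ℂ) else 0) 1 := by
    simpa using hasSum_ite_eq (0 : ℕ) (1 : ℂ)
  convert! h2.add h1 using 1
  · ext k
    split_ifs with h <;> simp [h]
    norm_num
  · have h3 := one_sub_ne_zero_of_mem_disk hw
    have h4 : w - 1 ≠ 0 := by rwa [← neg_sub, neg_ne_zero]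
    field_simp
    ring

lemma differentiableOn_add_one_div_sub_one {α : ℂ} (hα : ‖α‖ = 1) :
    DifferentiableOn ℂ (fun z => (α * z + 1) / (α * z - 1)) disk := by
  refine DifferentiableOn.div (by fun_prop) (by fun_prop) fun z hz h => ?_
  refine one_sub_ne_zero_of_mem_disk (mul_mem_disk hα.le hz) ?_
  rw [← neg_sub, h, neg_zero]

lemma coeff_add_one_div_sub_one {α : ℂ} (hα : ‖α‖ = 1) (k : ℕ) :
    coeff (fun z => (α * z + 1) / (α * z - 1)) k = if k = 0 then -1 else -2 * α ^ k := by
  rw [coeff_eq_of_hasSum (c := fun k : ℕ => (if k = 0 then -1 else -2) * α ^ k)]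
  · split_ifs with h <;> simp [h]
  · intro z hz
    simpa [mul_pow, mul_assoc] using hasSum_add_one_div_sub_one (mul_mem_disk hα.le hz)

lemma re_add_one_div_sub_one_nonpos {α z : ℂ} (hα : ‖α‖ = 1) (hz : z ∈ disk) :
    ((α * z + 1) / (α * z - 1)).re ≤ 0 := by
  have h := re_sub_one_div_add_one_nonpos (w := -(α * z))
    (by simpa [hα] using (mem_disk.1 hz).le)
  rwa [show (-(α * z) - 1) / (-(α * z) + 1) = (α * z + 1) / (α * z - 1) by
    rw [← neg_div_neg_eq]; congr 1 <;> ring] at h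

lemma krzyzLog_eq (z : ℂ) : (z - 1) / (z + 1) = (-1 * z + 1) / (-1 * z - 1) := by
  rw [← neg_div_neg_eq]
  congr 1 <;> ring

lemma coeff_krzyzLog (k : ℕ) :
    coeff (fun z => (z - 1) / (z + 1)) k = if k = 0 then -1 else -2 * (-1) ^ k := by
  simp only [krzyzLog_eq]
  exact coeff_add_one_div_sub_one (by simp) k

lemma differentiableOn_krzyzLog : DifferentiableOn ℂ (fun z : ℂ => (z - 1) / (z + 1)) disk := by
  simp only [krzyzLog_eq]
  exact differentiableOn_add_one_div_sub_one (by simp)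

/-- Taylor's formula with an analytic remainder, for a bounded function. -/
lemma exists_taylor_remainder {f : ℂ → ℂ} (hf : DifferentiableOn ℂ f disk)
    (hb : ∀ z ∈ disk, ‖f z‖ ≤ 1) (m : ℕ) : ∃ K : ℂ → ℂ, DifferentiableOn ℂ K disk ∧
      ∀ z ∈ disk, f z = ∑ k ∈ Finset.range m, coeff f k * z ^ k + z ^ m * K z := by
  have hs : ∀ z ∈ disk, HasSum (fun k => coeff f (k + m) * z ^ k)
      (∑' k, coeff f (k + m) * z ^ k) := fun z hz => by
    refine Summable.hasSum ?_
    refine Summable.of_norm_bounded (g := fun k => ‖z‖ ^ k)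
      (summable_geometric_of_lt_one (norm_nonneg _) (mem_disk.1 hz)) fun k => ?_
    rw [norm_mul, norm_pow]
    exact mul_le_of_le_one_left (by positivity) (norm_coeff_le hf hb _)
  refine ⟨fun z => ∑' k, coeff f (k + m) * z ^ k, differentiableOn_of_hasSum hs, fun z hz => ?_⟩
  have h1 := hasSum_coeff hf hz
  rw [← h1.summable.sum_add_tsum_nat_add m |>.trans h1.tsum_eq]
  rw [← tsum_mul_left]
  congr 2
  ext k
  ring

/-- `exp ((w - 1)/(w + 1)) = e⁻¹ (1 + 2w + O(w³))`: the quadratic term vanishes. -/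
lemma exists_exp_krzyzLog_eq : ∃ K : ℂ → ℂ, DifferentiableOn ℂ K disk ∧ ∀ z ∈ disk,
    Complex.exp ((z - 1) / (z + 1)) =
      Complex.exp (-1) + 2 * Complex.exp (-1) * z + z ^ 3 * K z := by
  set F : ℂ → ℂ := fun z => Complex.exp ((z - 1) / (z + 1)) with hF
  have hFd : DifferentiableOn ℂ F disk := differentiableOn_krzyzLog.cexp
  have hFb : ∀ z ∈ disk, ‖F z‖ ≤ 1 := fun z hz => by
    simp only [hF]
    rw [Complex.norm_exp]
    simpa using re_sub_one_div_add_one_nonpos (mem_disk.1 hz).le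
  have h0 : coeff F 0 = Complex.exp (-1) := by simp [coeff_zero, hF]
  have hrec := recursion_of_exp (f := F) differentiableOn_krzyzLog (fun z _ => rfl) 2
  have h1 : coeff F 1 = 2 * Complex.exp (-1) := by
    rw [hrec 1 le_rfl (by norm_num)]
    simp [coeff_krzyzLog, h0, mul_comm]
  have h2 : coeff F 2 = 0 := by
    rw [hrec 2 (by norm_num) le_rfl, Finset.sum_Icc_succ_top (by norm_num)]
    simp [coeff_krzyzLog, h0, h1]
  obtain ⟨K, hK, hKe⟩ := exists_taylor_remainder hFd hFb 3
  refine ⟨K, hK, fun z hz => ?_⟩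
  have := hKe z hz
  simp only [Finset.sum_range_succ, Finset.sum_range_zero, h0, h1, h2] at this
  simp only [hF] at this
  rw [this]
  ring

lemma pow_mul_mem_disk {H : ℂ → ℂ} (hb : ∀ z ∈ disk, ‖H z‖ ≤ 1) {k : ℕ} (hk : k ≠ 0) {z : ℂ}
    (hz : z ∈ disk) : z ^ k * H z ∈ disk := by
  rw [mul_comm]
  exact mul_mem_disk (hb z hz) (pow_mem_disk hz hk)

/-- Substituting `w = z^k H(z)`, `|H| ≤ 1`, in `exp ((w - 1)/(w + 1))`: since there is no quadratic
term, the coefficients of index below `3k` are those of `2 e⁻¹ z^k H(z)`. -/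
lemma coeff_exp_krzyzLog_comp {H : ℂ → ℂ} (hH : DifferentiableOn ℂ H disk)
    (hb : ∀ z ∈ disk, ‖H z‖ ≤ 1) {k n : ℕ} (hn : n ≠ 0) (hk : n < 3 * k) :
    coeff (fun z => Complex.exp ((z ^ k * H z - 1) / (z ^ k * H z + 1))) n =
      2 * Complex.exp (-1) * coeff (fun z => z ^ k * H z) n := by
  obtain ⟨K, hK, hKe⟩ := exists_exp_krzyzLog_eq
  have hk0 : k ≠ 0 := by omega
  have hφ : DifferentiableOn ℂ (fun z => z ^ k * H z) disk := by fun_prop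
  have hR : DifferentiableOn ℂ (fun z => H z ^ 3 * K (z ^ k * H z)) disk :=
    (hH.pow 3).mul (hK.comp hφ fun z hz => pow_mul_mem_disk hb hk0 hz)
  have heq : EqOn (fun z => Complex.exp ((z ^ k * H z - 1) / (z ^ k * H z + 1)))
      (fun z => (Complex.exp (-1) + 2 * Complex.exp (-1) * (z ^ k * H z)) +
        z ^ (3 * k) * (H z ^ 3 * K (z ^ k * H z))) disk := fun z hz => by
    simp only [hKe _ (pow_mul_mem_disk hb hk0 hz)]
    ring
  rw [coeff_congr heq, coeff_add (by fun_prop) (by fun_prop), coeff_pow_mul _ hR,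
    if_neg (by omega), add_zero, coeff_add (by fun_prop) (by fun_prop), coeff_const, if_neg hn,
    zero_add, coeff_const_mul _ hφ]

lemma coeff_krzyzFun_self {n : ℕ} (hn : n ≠ 0) :
    coeff (krzyzFun n) n = 2 * Complex.exp (-1) := by
  have := coeff_exp_krzyzLog_comp (H := fun _ => 1) (k := n) (n := n) (by fun_prop) (by simp) hn
    (by omega)
  simp only [mul_one] at this
  rw [coeff_pow, if_pos rfl, mul_one] at this
  exact this

lemma differentiableOn_krzyzLog_pow {n : ℕ} (hn : n ≠ 0) :
    DifferentiableOn ℂ (fun z : ℂ => (z ^ n - 1) / (z ^ n + 1)) disk :=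
  differentiableOn_krzyzLog.comp (f := fun z => z ^ n) (by fun_prop)
    fun _ hz => pow_mem_disk hz hn

lemma normalized_of_exp {g : ℂ → ℂ} (hg : DifferentiableOn ℂ g disk)
    (hre : ∀ z ∈ disk, (g z).re ≤ 0) (h0 : (g 0).im = 0) :
    Normalized (fun z => Complex.exp (g z)) := by
  refine ⟨⟨hg.cexp, fun z hz => ?_⟩, ?_, ?_⟩
  · rw [Complex.norm_exp]
    exact ⟨Real.exp_pos _, by simpa using hre z hz⟩
  · rw [coeff_zero, Complex.exp_im, h0]
    simp
  · rw [coeff_zero, Complex.exp_re, h0]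
    simp [Real.exp_pos]

lemma normalized_krzyzFun {n : ℕ} (hn : n ≠ 0) : Normalized (krzyzFun n) :=
  normalized_of_exp (differentiableOn_krzyzLog_pow hn)
    (fun _ hz => re_sub_one_div_add_one_nonpos (mem_disk.1 (pow_mem_disk hz hn)).le) (by simp [hn])

/-! ### First properties of extremal functions -/

lemma two_mul_exp_neg_one_le {n : ℕ} (hn : n ≠ 0) {f : ℂ → ℂ} (hf : IsExtremal n f) :
    2 * Real.exp (-1) ≤ (coeff f n).re := by
  have := hf.2 _ (normalized_krzyzFun hn)
  rw [coeff_krzyzFun_self hn, show (2 : ℂ) * Complex.exp (-1) = ((2 * Real.exp (-1) : ℝ) : ℂ) by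
    push_cast; rfl, Complex.ofReal_re] at this
  exact this

lemma exists_norm_eq_one_mul_eq_norm (a : ℂ) : ∃ u : ℂ, ‖u‖ = 1 ∧ u * a = (‖a‖ : ℂ) := by
  by_cases h : a = 0
  · exact ⟨1, by simp, by simp [h]⟩
  · have h' : (‖a‖ : ℂ) ≠ 0 := by simpa using h
    refine ⟨‖a‖ / a, by simp [h], by field_simp⟩

/-- Rotations of the disk and of the values turn any function of the class into a normalized one
with `a_n = |a_n|`. -/
lemma IsExtremal.norm_coeff_le_re {n : ℕ} (hn : n ≠ 0) {f : ℂ → ℂ} (hf : IsExtremal n f) {h : ℂ → ℂ}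
    (hh : BStar h) : ‖coeff h n‖ ≤ (coeff f n).re := by
  obtain ⟨u, hu, hu'⟩ := exists_norm_eq_one_mul_eq_norm (coeff h 0)
  obtain ⟨v, hv, hv'⟩ := exists_norm_eq_one_mul_eq_norm (u * coeff h n)
  obtain ⟨c, hc⟩ := IsAlgClosed.exists_pow_nat_eq v (Nat.pos_of_ne_zero hn)
  have hc1 : ‖c‖ = 1 := by
    rw [← pow_eq_one_iff_of_nonneg (norm_nonneg _) hn, ← norm_pow, hc, hv]
  have hd := differentiableOn_comp_mul hc1.le hh.1
  have hcoef : ∀ k, coeff (fun z => u * h (c * z)) k = u * (c ^ k * coeff h k) := fun k => by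
    rw [coeff_const_mul _ hd, coeff_comp_mul hc1.le hh.1]
  have hnorm : Normalized (fun z => u * h (c * z)) := by
    refine ⟨⟨hd.const_mul u, fun z hz => ?_⟩, ?_, ?_⟩
    · rw [norm_mul, hu, one_mul]
      exact hh.2 _ (mul_mem_disk hc1.le hz)
    · rw [hcoef, pow_zero, one_mul, hu', Complex.ofReal_im]
    · rw [hcoef, pow_zero, one_mul, hu', Complex.ofReal_re, coeff_zero]
      exact (hh.2 0 zero_mem_disk).1
  have := hf.2 _ hnorm
  rw [hcoef, hc, show u * (v * coeff h n) = v * (u * coeff h n) by ring, hv', Complex.ofReal_re,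
    norm_mul, hu, one_mul] at this
  exact this

lemma IsExtremal.coeff_eq_ofReal {n : ℕ} (hn : n ≠ 0) {f : ℂ → ℂ} (hf : IsExtremal n f) :
    coeff f n = ((coeff f n).re : ℂ) := by
  have h1 := hf.norm_coeff_le_re hn hf.1.1
  have h2 : (coeff f n).re = ‖coeff f n‖ := le_antisymm (Complex.re_le_norm _) h1
  exact Complex.ext rfl (Complex.nonneg_iff.1 (Complex.re_eq_norm.1 h2)).2.symm

lemma IsExtremal.coeff_zero_eq_ofReal {n : ℕ} {f : ℂ → ℂ} (hf : IsExtremal n f) :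
    coeff f 0 = ((coeff f 0).re : ℂ) :=
  Complex.ext rfl hf.1.2.1

lemma IsExtremal.exists_log {n : ℕ} (hn : n ≠ 0) {f : ℂ → ℂ} (hf : IsExtremal n f) :
    ∃ g, IsNormalizedLog f g := by
  obtain ⟨g, hg, he, t, ht⟩ := hf.1.exists_log
  have hre := hf.1.1.re_le he
  refine ⟨g, hg, he, by simp [ht], ?_⟩
  by_contra hcon
  have ht0 : t ≤ 0 := by simpa [ht] using hcon
  have hb : ∀ k, k ≠ 0 → coeff g k = 0 := fun k hk => by
    have := norm_coeff_le_two_mul hg hre ht hk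
    exact norm_le_zero_iff.1 (this.trans (by linarith))
  have := recursion_of_exp hg he n n (by omega) le_rfl
  rw [Finset.sum_eq_zero fun j hj => by
    rw [hb j (by have := (Finset.mem_Icc.1 hj).1; omega), mul_zero]] at this
  have h2 := two_mul_exp_neg_one_le hn hf
  rw [this] at h2
  have := Real.exp_pos (-1)
  simp at h2
  linarith

/-- First variation: if `f = e^g` is extremal and `f e^{sG}` is admissible for `0 < s ≤ 1`, then the
derivative `Re {f G}_n` of its `n`-th coefficient at `s = 0` is nonpositive. -/
theorem IsExtremal.variation {n : ℕ} {f g G : ℂ → ℂ} (hf : IsExtremal n f)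
    (hg : IsNormalizedLog f g) (hG : DifferentiableOn ℂ G disk) (hG0 : (G 0).im = 0)
    (hre : ∀ s : ℝ, 0 < s → s ≤ 1 → ∀ z ∈ disk, (g z + s * G z).re ≤ 0) :
    (coeff (fun z => f z * G z) n).re ≤ 0 := by
  have hfd := hf.1.1.1
  have hsub : closedBall (0 : ℂ) (1 / 2) ⊆ disk := closedBall_subset_ball (by norm_num)
  obtain ⟨C, hC⟩ := (isCompact_closedBall (0 : ℂ) (1 / 2)).exists_bound_of_continuousOn
    (hG.continuousOn.mono hsub)
  have key : ∀ s : ℝ, 0 < s → s ≤ 1 → s * |C| ≤ 1 →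
      (coeff (fun z => f z * G z) n).re ≤ s * (|C| ^ 2 / (1 / 2) ^ n) := by
    intro s hs hs1 hsC
    have hadm : Normalized (fun z => Complex.exp (g z + s * G z)) :=
      normalized_of_exp (hg.1.add (hG.const_mul _)) (hre s hs hs1) (by
        have := hg.2.2.1
        rw [coeff_zero] at this
        simp [this, hG0])
    have hmax := hf.2 _ hadm
    have hrd : DifferentiableOn ℂ (fun z => Complex.exp (s * G z) - 1 - s * G z) disk :=
      ((hG.const_mul _).cexp.sub_const _).sub (hG.const_mul _)
    have heq : EqOn (fun z => Complex.exp (g z + s * G z)) (fun z => (f z + s * (f z * G z)) +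
        f z * (Complex.exp (s * G z) - 1 - s * G z)) disk := fun z hz => by
      simp only [Complex.exp_add, hg.2.1 z hz]
      ring
    have hrem := norm_coeff_le_div_pow (hfd.mul hrd) (r := 1 / 2) (C := (s * |C|) ^ 2) (by norm_num)
      (by norm_num) (fun z hz => by
        have hzd : z ∈ disk := mem_disk.2 (by linarith)
        have h1 : ‖s * G z‖ ≤ s * |C| := by
          rw [norm_mul, Complex.norm_real, Real.norm_of_nonneg hs.le]
          gcongr
          exact (hC z (by simpa using hz)).trans (le_abs_self _)
        have h2 := Complex.norm_exp_sub_one_sub_id_le (h1.trans hsC)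
        rw [Pi.mul_apply, norm_mul]
        calc _ ≤ 1 * ‖s * G z‖ ^ 2 := by gcongr; exact (hf.1.1.2 z hzd).2
          _ ≤ (s * |C|) ^ 2 := by rw [one_mul]; gcongr) n
    rw [coeff_congr heq, coeff_add (by fun_prop) (by fun_prop), coeff_add (by fun_prop)
      (by fun_prop), coeff_const_mul _ (by fun_prop), Complex.add_re, Complex.add_re,
      Complex.re_ofReal_mul] at hmax
    have hrem' := (abs_le.1 ((Complex.abs_re_le_norm _).trans hrem)).1
    refine le_of_mul_le_mul_left (a := s) ?_ hs
    have : s * (s * (|C| ^ 2 / (1 / 2) ^ n)) = (s * |C|) ^ 2 / (1 / 2) ^ n := by ring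
    rw [this]
    change -_ ≤ (coeff (fun z => f z * _) n).re at hrem'
    linarith
  have hlim : Tendsto (fun s : ℝ => s * (|C| ^ 2 / (1 / 2) ^ n)) (𝓝[>] 0) (𝓝 0) := by
    have : Continuous (fun s : ℝ => s * (|C| ^ 2 / (1 / 2) ^ n)) := by fun_prop
    simpa using (this.tendsto 0).mono_left nhdsWithin_le_nhds
  refine ge_of_tendsto hlim ?_
  have h1 : ∀ᶠ s : ℝ in 𝓝[>] 0, s * |C| ≤ 1 := by
    have : Tendsto (fun s : ℝ => s * |C|) (𝓝[>] 0) (𝓝 0) := by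
      have : Continuous (fun s : ℝ => s * |C|) := by fun_prop
      simpa using (this.tendsto 0).mono_left nhdsWithin_le_nhds
    exact (this.eventually_lt_const one_pos).mono fun _ h => h.le
  filter_upwards [h1, Ioc_mem_nhdsGT (zero_lt_one' ℝ)] with s h1 h2
  exact key s h2.1 h2.2 h1

/-- Varying `f = e^g` within the powers `e^{sg}`. -/
lemma IsExtremal.re_coeff_mul_log {n : ℕ} {f g : ℂ → ℂ} (hf : IsExtremal n f)
    (hg : IsNormalizedLog f g) :
    (∑ k ∈ Finset.range (n + 1), coeff f k * coeff g (n - k)).re = 0 := by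
  have hre := hf.1.1.re_le hg.2.1
  have h0 : (g 0).im = 0 := by rw [← coeff_zero g]; exact hg.2.2.1
  have h1 := hf.variation hg hg.1 h0 fun s hs _ z hz => by
    rw [Complex.add_re, Complex.re_ofReal_mul]
    nlinarith [hre z hz]
  have h2 := hf.variation hg (G := fun z => (-1) * g z) (by have := hg.1; fun_prop) (by simp [h0])
    fun s _ hs z hz => by
      rw [Complex.add_re, Complex.re_ofReal_mul]
      simp only [neg_mul, one_mul, Complex.neg_re]
      nlinarith [hre z hz]
  have h3 : (fun z => f z * (-1 * g z)) = fun z => -1 * (f z * g z) := by ext z; ring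
  rw [h3, coeff_const_mul _ (hf.1.1.1.fun_mul hg.1)] at h2
  rw [coeff_mul hf.1.1.1 hg.1] at h1 h2
  simp only [neg_mul, one_mul, Complex.neg_re] at h2
  linarith

/-- Multiplying `f` by small powers of `exp ((αz + 1)/(αz - 1))` shows that the real part of the
polynomial `P` is nonnegative on the unit circle. -/
lemma IsExtremal.re_trig_nonneg {n : ℕ} {f g : ℂ → ℂ} (hf : IsExtremal n f)
    (hg : IsNormalizedLog f g) {α : ℂ} (hα : ‖α‖ = 1) :
    0 ≤ (coeff f n + 2 * ∑ k ∈ Finset.Icc 1 n, coeff f (n - k) * α ^ k).re := by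
  have hre := hf.1.1.re_le hg.2.1
  have hd := differentiableOn_add_one_div_sub_one hα
  have h1 := hf.variation hg hd (by simp) fun s hs _ z hz => by
    rw [Complex.add_re, Complex.re_ofReal_mul]
    nlinarith [hre z hz, re_add_one_div_sub_one_nonpos hα hz]
  have h2 : (fun z => f z * ((α * z + 1) / (α * z - 1))) =
      fun z => ((α * z + 1) / (α * z - 1)) * f z := by ext z; ring
  rw [h2, coeff_mul hd hf.1.1.1] at h1
  rw [← Finset.Ico_succ_right_eq_Icc, Order.succ_eq_add_one, Finset.mul_sum]
  rw [Finset.range_eq_Ico, Finset.sum_eq_sum_Ico_succ_bot (by omega)] at h1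
  rw [coeff_add_one_div_sub_one hα, if_pos rfl, zero_add,
    Finset.sum_congr rfl (g := fun k => -(2 * (coeff f (n - k) * α ^ k))) fun k hk => by
      rw [coeff_add_one_div_sub_one hα, if_neg (by have := (Finset.mem_Ico.1 hk).1; omega)]; ring,
    Finset.sum_neg_distrib] at h1
  simp only [neg_mul, one_mul, Complex.add_re, Complex.neg_re, Nat.sub_zero] at h1
  rw [Complex.add_re]
  linarith

/-! ### The recursion between the coefficients of a function and of its logarithm -/

lemma Recursion.mono {m n : ℕ} {a b : ℕ → ℂ} (h : Recursion n a b) (hmn : m ≤ n) :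
    Recursion m a b := fun k h1 h2 => h k h1 (h2.trans hmn)

lemma Recursion.eq_of_left_eq_zero {n : ℕ} (hn : n ≠ 0) {a b : ℕ → ℂ} (h : Recursion n a b)
    (ha : ∀ k, 1 ≤ k → k < n → a k = 0) : a n = a 0 * b n := by
  have hn' : (n : ℂ) ≠ 0 := by exact_mod_cast hn
  rw [h n (by omega) le_rfl, Finset.sum_eq_single_of_mem n (by simp; omega)]
  · rw [Nat.sub_self, div_self hn', one_mul]
  · intro j hj hjn
    have := Finset.mem_Icc.1 hj
    rw [ha (n - j) (by omega) (by omega), mul_zero, zero_mul]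

lemma Recursion.eq_of_right_eq_zero {n : ℕ} (hn : n ≠ 0) {a b : ℕ → ℂ} (h : Recursion n a b)
    (hb : ∀ k, 1 ≤ k → k < n → b k = 0) : a n = a 0 * b n := by
  have hn' : (n : ℂ) ≠ 0 := by exact_mod_cast hn
  rw [h n (by omega) le_rfl, Finset.sum_eq_single_of_mem n (by simp; omega)]
  · rw [Nat.sub_self, div_self hn', one_mul]
  · intro j hj hjn
    have := Finset.mem_Icc.1 hj
    rw [hb j (by omega) (by omega), mul_zero]

lemma Recursion.left_eq_zero_iff {n : ℕ} {a b : ℕ → ℂ} (h : Recursion n a b) (h0 : a 0 ≠ 0) :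
    (∀ k, 1 ≤ k → k < n → a k = 0) ↔ (∀ k, 1 ≤ k → k < n → b k = 0) := by
  refine ⟨fun ha k h1 h2 => ?_, fun hb k h1 h2 => ?_⟩
  · have := (h.mono h2.le).eq_of_left_eq_zero (by omega) fun j hj1 hj2 => ha j hj1 (by omega)
    rw [ha k h1 h2] at this
    exact (mul_eq_zero.1 this.symm).resolve_left h0
  · rw [(h.mono h2.le).eq_of_right_eq_zero (by omega) fun j hj1 hj2 => hb j hj1 (by omega),
      hb k h1 h2, mul_zero]

/-! ### Numerical data of an extremal function -/

lemma IsNormalizedLog.exists_pos {f g : ℂ → ℂ} (hg : IsNormalizedLog f g) :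
    ∃ t : ℝ, 0 < t ∧ coeff g 0 = -t ∧ coeff f 0 = (Real.exp (-t) : ℂ) := by
  have h0 : coeff g 0 = -((-(coeff g 0).re : ℝ) : ℂ) :=
    Complex.ext (by simp) (by simpa using hg.2.2.1)
  refine ⟨-(coeff g 0).re, by linarith [hg.2.2.2], h0, ?_⟩
  rw [coeff_zero f, hg.2.1 0 zero_mem_disk, ← coeff_zero g, h0]
  simp

/-- `2te^{-t} ≤ 2/e`, with equality only for `t = 1`. -/
lemma eq_one_of_exp_le {t : ℝ} (h : 2 * Real.exp (-1) ≤ 2 * t * Real.exp (-t)) : t = 1 := by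
  by_contra hne
  have h1 := Real.add_one_lt_exp (x := t - 1) (sub_ne_zero.2 hne)
  have h2 : Real.exp (t - 1) * Real.exp (-t) = Real.exp (-1) := by
    rw [← Real.exp_add]; congr 1; ring
  have := mul_lt_mul_of_pos_right h1 (Real.exp_pos (-t))
  rw [h2] at this
  linarith

/-- If the logarithmic bound `|a_n| ≤ 2te^{-t}`, `a_0 = e^{-t}`, holds for an extremal function, it
forces `a_0 = 1/e` and `a_n = 2/e`. -/
lemma IsExtremal.coeff_eq_of_le {n : ℕ} (hn : n ≠ 0) {f : ℂ → ℂ} (hf : IsExtremal n f) {t : ℝ}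
    (h0 : coeff f 0 = (Real.exp (-t) : ℂ)) (h : (coeff f n).re ≤ 2 * t * Real.exp (-t)) :
    coeff f n = 2 * coeff f 0 := by
  have h1 := two_mul_exp_neg_one_le hn hf
  obtain rfl := eq_one_of_exp_le (h1.trans h)
  rw [hf.coeff_eq_ofReal hn, h0]
  have : (coeff f n).re = 2 * Real.exp (-1) := by linarith
  rw [this]
  push_cast
  rfl

/-- The identity `Re {f g}_n = 0` with the two extreme terms split off. -/
lemma IsExtremal.re_sum_Ico {n : ℕ} (hn : n ≠ 0) {f g : ℂ → ℂ} (hf : IsExtremal n f)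
    (hg : IsNormalizedLog f g) {t : ℝ} (hg0 : coeff g 0 = -t)
    (hf0 : coeff f 0 = (Real.exp (-t) : ℂ)) :
    Real.exp (-t) * (coeff g n).re + (∑ j ∈ Finset.Ico 1 n, coeff f j * coeff g (n - j)).re
      = (coeff f n).re * t := by
  have h := hf.re_coeff_mul_log hg
  rw [Finset.sum_range_succ, Finset.range_eq_Ico, Finset.sum_eq_sum_Ico_succ_bot (by omega),
    Nat.sub_self, hg0, hf0, Nat.sub_zero, hf.coeff_eq_ofReal hn] at h
  simp only [zero_add, Complex.add_re, Complex.re_ofReal_mul, Complex.neg_re,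
    Complex.ofReal_re] at h
  linarith

/-! ### The trigonometric polynomial `Re P` -/

/-- Orthogonality of the powers over the `n`-th roots of `-1`, parametrized as `ζ ω^j`. -/
lemma sum_root_pow {n : ℕ} (hn : n ≠ 0) (ζ : ℂ) (k : ℕ) :
    ∑ j ∈ Finset.range n, (ζ * rootUnity n ^ j) ^ k = if n ∣ k then n * ζ ^ k else 0 := by
  simp only [mul_pow, ← Finset.mul_sum]
  rw [sum_rootUnity_pow hn k]
  split_ifs
  · ring
  · simp

lemma exists_pow_eq_neg_one {n : ℕ} (hn : n ≠ 0) : ∃ ζ : ℂ, ζ ^ n = -1 :=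
  IsAlgClosed.exists_pow_nat_eq _ (Nat.pos_of_ne_zero hn)

lemma norm_eq_one_of_pow_eq_neg_one {n : ℕ} (hn : n ≠ 0) {α : ℂ} (h : α ^ n = -1) : ‖α‖ = 1 := by
  rw [← pow_eq_one_iff_of_nonneg (norm_nonneg _) hn, ← norm_pow, h, norm_neg, norm_one]

lemma root_pow {n : ℕ} (hn : n ≠ 0) {ζ : ℂ} (hζ : ζ ^ n = -1) (j : ℕ) :
    (ζ * rootUnity n ^ j) ^ n = -1 := by
  rw [mul_pow, rootUnity_pow_pow hn, hζ, mul_one]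

/-- A polynomial with exponents in `[1, n)` that vanishes at the `n`-th roots of `-1` is zero. -/
lemma eq_zero_of_sum_eq_zero {n : ℕ} {d : ℕ → ℂ}
    (h : ∀ α : ℂ, α ^ n = -1 → ∑ k ∈ Finset.Ico 1 n, d k * α ^ k = 0) {m : ℕ} (hm1 : 1 ≤ m)
    (hm : m < n) : d m = 0 := by
  have hn : n ≠ 0 := by omega
  obtain ⟨ζ, hζ⟩ := exists_pow_eq_neg_one hn
  have h1 : ∑ j ∈ Finset.range n, (∑ k ∈ Finset.Ico 1 n, d k * (ζ * rootUnity n ^ j) ^ k) *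
      (ζ * rootUnity n ^ j) ^ (n - m) = 0 :=
    Finset.sum_eq_zero fun j _ => by rw [h _ (root_pow hn hζ j), zero_mul]
  simp only [Finset.sum_mul, mul_assoc, ← pow_add] at h1
  rw [Finset.sum_comm] at h1
  simp only [← Finset.mul_sum, sum_root_pow hn] at h1
  rw [Finset.sum_eq_single_of_mem m (by simp; omega)] at h1
  · rw [show m + (n - m) = n by omega, if_pos dvd_rfl, hζ] at h1
    simpa [hn] using h1
  · intro k hk hkm
    have := Finset.mem_Ico.1 hk
    rw [if_neg, mul_zero]
    rintro ⟨c, hc⟩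
    have hc1 : 0 < c := by
      rcases Nat.eq_zero_or_pos c with rfl | h
      · omega
      · exact h
    have hc2 : c < 2 := by
      by_contra hcon
      have := Nat.mul_le_mul_left n (not_lt.1 hcon)
      omega
    obtain rfl : c = 1 := by omega
    omega

/-- The values of `Re P` at the `n`-th roots of `-1` have mean `a_n - 2 a_0`. -/
lemma sum_trig {n : ℕ} (hn : n ≠ 0) {ζ : ℂ} (hζ : ζ ^ n = -1) (a : ℕ → ℂ) :
    ∑ j ∈ Finset.range n, (a n + 2 * ∑ k ∈ Finset.Icc 1 n, a (n - k) * (ζ * rootUnity n ^ j) ^ k) =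
      n * (a n - 2 * a 0) := by
  rw [Finset.sum_add_distrib, ← Finset.mul_sum, Finset.sum_comm]
  simp only [← Finset.mul_sum, sum_root_pow hn]
  have h : ∑ k ∈ Finset.Icc 1 n, a (n - k) * (if n ∣ k then n * ζ ^ k else 0) = n * -a 0 := by
    rw [Finset.sum_eq_single_of_mem n (by simp; omega)]
    · rw [if_pos dvd_rfl, hζ, Nat.sub_self]
      ring
    · intro k hk hkn
      have := Finset.mem_Icc.1 hk
      rw [if_neg (Nat.not_dvd_of_pos_of_lt (by omega) (by omega)), mul_zero]
  rw [h, Finset.sum_const, Finset.card_range, nsmul_eq_mul]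
  ring

/-- In the extreme case `a_n = 2 a_0` the nonnegative function `Re P` has mean zero over the `n`-th
roots of `-1`, so it vanishes there together with its tangential derivative. These `2n` conditions
leave only `a_n (1 + Re z^n)`. -/
theorem IsExtremal.coeff_eq_zero {n : ℕ} (hn : n ≠ 0) {f g : ℂ → ℂ} (hf : IsExtremal n f)
    (hg : IsNormalizedLog f g) (h : coeff f n = 2 * coeff f 0) {m : ℕ} (hm1 : 1 ≤ m)
    (hm : m < n) : coeff f m = 0 := by
  set a := coeff f with ha
  have ha0 := hf.coeff_zero_eq_ofReal
  rw [← ha] at ha0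
  set T : ℂ → ℝ := fun α => (a n + 2 * ∑ k ∈ Finset.Icc 1 n, a (n - k) * α ^ k).re with hT
  have hTnn : ∀ α : ℂ, ‖α‖ = 1 → 0 ≤ T α := fun α hα => hf.re_trig_nonneg hg hα
  have hT0 : ∀ α : ℂ, α ^ n = -1 → T α = 0 := fun α hα => by
    have h1 := congrArg Complex.re (sum_trig hn hα a)
    rw [h, sub_self, mul_zero, Complex.re_sum, Complex.zero_re] at h1
    have h2 := (Finset.sum_eq_zero_iff_of_nonneg fun j _ => by
      have := hTnn _ (norm_eq_one_of_pow_eq_neg_one hn (root_pow hn hα j))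
      simp only [hT, h] at this
      exact this).1 h1 0 (by simp; omega)
    simp only [pow_zero, mul_one] at h2
    simp only [hT, h]
    exact h2
  have hIcc : ∀ F : ℕ → ℂ, ∑ k ∈ Finset.Icc 1 n, F k = ∑ k ∈ Finset.Ico 1 n, F k + F n :=
    fun F => by
      rw [← Finset.Ico_succ_right_eq_Icc, Order.succ_eq_add_one,
        Finset.sum_Ico_succ_top (by omega)]
  -- The conjugate of `F(k) α^k` is `-conj(F(k)) α^(n-k)` when `α^n = -1`.
  have hconj : ∀ α : ℂ, α ^ n = -1 → ∀ F : ℕ → ℂ,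
      (starRingEnd ℂ) (∑ k ∈ Finset.Ico 1 n, F k * α ^ k) =
        -∑ k ∈ Finset.Ico 1 n, (starRingEnd ℂ) (F (n - k)) * α ^ k := fun α hα F => by
    have h1 := Complex.mul_conj α
    rw [Complex.normSq_eq_norm_sq, norm_eq_one_of_pow_eq_neg_one hn hα, one_pow,
      Complex.ofReal_one] at h1
    have h3 := Finset.sum_Ico_reflect (fun k => (starRingEnd ℂ) (F (n - k)) * α ^ k) 1
      (m := n) (n := n) (by omega)
    rw [show n + 1 - n = 1 by omega, show n + 1 - 1 = n by omega] at h3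
    rw [← h3, map_sum, ← Finset.sum_neg_distrib]
    refine Finset.sum_congr rfl fun k hk => ?_
    have hk' := Finset.mem_Ico.1 hk
    rw [show n - (n - k) = k by omega, map_mul, map_pow]
    have h2 : α ^ (n - k) * α ^ k = -1 := by rw [← pow_add, ← hα]; congr 1; omega
    have h4 : α ^ k * (starRingEnd ℂ) α ^ k = 1 := by rw [← mul_pow, h1, one_pow]
    linear_combination (starRingEnd ℂ) (F k) * (-(α ^ (n - k)) * h4 +
      (starRingEnd ℂ) α ^ k * h2)
  have hval : ∀ α : ℂ, α ^ n = -1 → ∑ k ∈ Finset.Ico 1 n,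
      (a (n - k) - (starRingEnd ℂ) (a (n - (n - k)))) * α ^ k = 0 := fun α hα => by
    have h1 := hT0 α hα
    simp only [hT] at h1
    rw [hIcc, hα, Nat.sub_self, h, ha0] at h1
    have h2 : (∑ k ∈ Finset.Ico 1 n, a (n - k) * α ^ k).re = 0 := by
      generalize ∑ k ∈ Finset.Ico 1 n, a (n - k) * α ^ k = S at h1
      simp at h1
      linarith
    have h3 := Complex.add_conj (∑ k ∈ Finset.Ico 1 n, a (n - k) * α ^ k)
    rw [hconj α hα, h2] at h3
    simp only [sub_mul, Finset.sum_sub_distrib]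
    simpa [sub_eq_add_neg] using h3
  have hder : ∀ α : ℂ, α ^ n = -1 → ∑ k ∈ Finset.Ico 1 n,
      (k * a (n - k) + (n - k : ℕ) * (starRingEnd ℂ) (a (n - (n - k)))) * α ^ k = 0 := fun α hα => by
    have hα1 := norm_eq_one_of_pow_eq_neg_one hn hα
    set E : ℝ → ℂ := fun θ => a n + 2 * ∑ k ∈ Finset.Icc 1 n,
      a (n - k) * (α * Complex.exp (θ * Complex.I)) ^ k with hE
    have hexp : HasDerivAt (fun θ : ℝ => α * Complex.exp (θ * Complex.I)) (α * Complex.I) 0 := by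
      have := ((Complex.ofRealCLM.hasDerivAt (x := (0 : ℝ))).mul_const Complex.I).cexp.const_mul α
      simpa using this
    have hEd : HasDerivAt E (2 * ∑ k ∈ Finset.Icc 1 n,
        a (n - k) * (k * α ^ (k - 1) * (α * Complex.I))) 0 := by
      refine HasDerivAt.const_add _ (HasDerivAt.const_mul _ (HasDerivAt.fun_sum fun k _ => ?_))
      have := (hexp.fun_pow k).const_mul (a (n - k))
      simpa using this
    have hmin : IsLocalMin (fun θ => (E θ).re) 0 := by
      refine Filter.Eventually.of_forall fun θ => ?_
      have h1 : (E 0).re = 0 := by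
        have := hT0 α hα
        simpa [hE, hT] using this
      change (E 0).re ≤ (E θ).re
      rw [h1]
      exact hTnn _ (by rw [norm_mul, hα1, Complex.norm_exp_ofReal_mul_I, one_mul])
    have hz := hmin.hasDerivAt_eq_zero
      (Complex.reCLM.hasFDerivAt.comp_hasDerivAt (0 : ℝ) hEd)
    have hterm : ∀ k ∈ Finset.Icc 1 n, a (n - k) * (k * α ^ (k - 1) * (α * Complex.I)) =
        Complex.I * (k * a (n - k) * α ^ k) := fun k hk => by
      have := Finset.mem_Icc.1 hk
      have h1 : α ^ k = α ^ (k - 1) * α := by rw [← pow_succ]; congr 1; omega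
      rw [h1]
      ring
    rw [Finset.sum_congr rfl hterm, ← Finset.mul_sum, hIcc, hα, Nat.sub_self, ha0] at hz
    simp only [Complex.reCLM_apply] at hz
    have h2 : (∑ k ∈ Finset.Ico 1 n, k * a (n - k) * α ^ k).im = 0 := by
      simpa using hz
    have h3 := Complex.sub_conj (∑ k ∈ Finset.Ico 1 n, k * a (n - k) * α ^ k)
    rw [hconj α hα (fun k => k * a (n - k)), h2] at h3
    simp only [add_mul, Finset.sum_add_distrib]
    simpa using h3
  have h1 := eq_zero_of_sum_eq_zero hval (m := n - m) (by omega) (by omega)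
  have h2 := eq_zero_of_sum_eq_zero hder (m := n - m) (by omega) (by omega)
  rw [show n - (n - m) = m by omega] at h1 h2
  have h3 : (n : ℂ) ≠ 0 := by exact_mod_cast hn
  rw [Nat.cast_sub hm.le] at h2
  have h4 : (n : ℂ) * a m = 0 := by linear_combination h2 + (m : ℂ) * h1
  exact (mul_eq_zero.1 h4).resolve_left h3

lemma IsExtremal.two_mul_coeff_zero_le {n : ℕ} (hn : n ≠ 0) {f g : ℂ → ℂ} (hf : IsExtremal n f)
    (hg : IsNormalizedLog f g) : 2 * (coeff f 0).re ≤ (coeff f n).re := by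
  obtain ⟨ζ, hζ⟩ := exists_pow_eq_neg_one hn
  have h1 := congrArg Complex.re (sum_trig hn hζ (coeff f))
  rw [Complex.re_sum] at h1
  have h2 : 0 ≤ ∑ j ∈ Finset.range n, (coeff f n + 2 * ∑ k ∈ Finset.Icc 1 n,
      coeff f (n - k) * (ζ * rootUnity n ^ j) ^ k).re :=
    Finset.sum_nonneg fun j _ =>
      hf.re_trig_nonneg hg (norm_eq_one_of_pow_eq_neg_one hn (root_pow hn hζ j))
  rw [h1] at h2
  have hn' : (0 : ℝ) < n := by positivity
  simp at h2
  have := nonneg_of_mul_nonneg_right h2 hn'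
  linarith

/-! ### The explicit extremal function -/

lemma coeff_zero_krzyzFun {n : ℕ} (hn : n ≠ 0) : coeff (krzyzFun n) 0 = Complex.exp (-1) := by
  simp [coeff_zero, krzyzFun, hn]

lemma coeff_krzyzFun_eq_zero {n k : ℕ} (hk1 : 1 ≤ k) (hk : k < n) : coeff (krzyzFun n) k = 0 := by
  have := coeff_exp_krzyzLog_comp (H := fun _ => 1) (k := n) (n := k) (by fun_prop) (by simp)
    (by omega) (by omega)
  simp only [mul_one] at this
  rw [coeff_pow, if_neg hk.ne, mul_zero] at this
  exact this

/-- An extremal function whose Taylor coefficients of index `1, …, n - 1` vanish is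
`exp ((z^n - 1)/(z^n + 1))`: the identity `Re {f g}_n = 0` gives `b_0 = -1`, then `b_n = 2`, and the
Cayley transform of `g` has the extreme coefficient `1`. -/
theorem IsExtremal.eqOn_krzyzFun {n : ℕ} (hn : n ≠ 0) {f g : ℂ → ℂ} (hf : IsExtremal n f)
    (hg : IsNormalizedLog f g) (h : ∀ k, 1 ≤ k → k < n → coeff f k = 0) :
    EqOn f (krzyzFun n) disk := by
  obtain ⟨t, ht, hg0, hf0⟩ := hg.exists_pos
  have hre := hf.1.1.re_le hg.2.1
  have hrec := recursion_of_exp hg.1 hg.2.1 n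
  have hb := (hrec.left_eq_zero_iff (by rw [hf0]; simp)).1 h
  have hsum := hf.re_sum_Ico hn hg hg0 hf0
  rw [Finset.sum_eq_zero fun j hj => by
    rw [h j (Finset.mem_Ico.1 hj).1 (Finset.mem_Ico.1 hj).2, zero_mul], Complex.zero_re,
    add_zero] at hsum
  have hA := two_mul_exp_neg_one_le hn hf
  have han := hrec.eq_of_left_eq_zero hn h
  have han' : (coeff f n).re = Real.exp (-t) * (coeff g n).re := by
    rw [han, hf0, Complex.re_ofReal_mul]
  have hpos : 0 < (coeff f n).re := lt_of_lt_of_le (by positivity) hA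
  obtain rfl : t = 1 := by
    rw [← han'] at hsum
    exact (mul_right_eq_self₀.1 hsum.symm).resolve_right hpos.ne'
  have hbn : coeff g n = 2 := by
    have h1 := norm_coeff_le_two_mul hg.1 hre hg0 hn
    have h2 : 2 ≤ (coeff g n).re := by
      rw [han'] at hA
      nlinarith [Real.exp_pos (-1)]
    have h3 : (coeff g n).re = ‖coeff g n‖ :=
      le_antisymm (Complex.re_le_norm _) (by linarith)
    have h4 := (Complex.nonneg_iff.1 (Complex.re_eq_norm.1 h3)).2
    exact Complex.ext (by simp; linarith) (by simpa using h4.symm)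
  have hc := fun k hk => coeff_cayley one_pos hg.1 hre hg0 hn hb (k := k) hk
  have hφ := eqOn_pow_of_coeff_eq_one (n := n) (differentiableOn_cayley one_pos hg.1 hre)
    (fun z hz => norm_cayley_le_one one_pos (hre z hz))
    (fun k hk => by rw [hc k hk.le, if_neg hk.ne]) (by rw [hc n le_rfl, if_pos rfl, hbn]; simp)
  intro z hz
  rw [hg.2.1 z hz, krzyzFun]
  congr 1
  have h1 := hφ hz
  have h2 := ofReal_sub_ne_zero one_pos (hre z hz)
  have h3 := add_one_ne_zero_of_mem_disk (pow_mem_disk hz hn)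
  simp only [Complex.ofReal_one] at h1 h2
  rw [div_eq_iff h2] at h1
  rw [eq_div_iff h3]
  linear_combination h1

lemma eqOn_krzyzLog {n : ℕ} (hn : n ≠ 0) {f g : ℂ → ℂ} (hg : IsNormalizedLog f g)
    (h : EqOn f (krzyzFun n) disk) : EqOn g (fun z => (z ^ n - 1) / (z ^ n + 1)) disk := by
  have he : ∀ z ∈ disk, Complex.exp (g z) = Complex.exp ((z ^ n - 1) / (z ^ n + 1)) :=
    fun z hz => by rw [← hg.2.1 z hz, h hz, krzyzFun]
  refine eqOn_of_exp_eq hg.1 (differentiableOn_krzyzLog_pow hn) he ?_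
  obtain ⟨t, -, hg0, hf0⟩ := hg.exists_pos
  rw [coeff_congr h, coeff_zero_krzyzFun hn] at hf0
  have : t = 1 := by
    have h1 : Real.exp (-1) = Real.exp (-t) := by
      apply Complex.ofReal_injective
      rw [← hf0]
      push_cast
      rfl
    have := Real.exp_injective h1
    linarith
  rw [← coeff_zero g, hg0, this]
  simp [hn]

lemma coeff_eq_two_mul_of_eqOn {n : ℕ} (hn : n ≠ 0) {f : ℂ → ℂ}
    (h : EqOn f (krzyzFun n) disk) : coeff f n = 2 * coeff f 0 := by
  rw [coeff_congr h, coeff_congr h, coeff_krzyzFun_self hn, coeff_zero_krzyzFun hn]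

/-- Partial fractions over the `n`-th roots of `-1`, by summing geometric progressions. -/
lemma krzyzLog_eq_sum {n : ℕ} (hn : n ≠ 0) {ζ : ℂ} (hζ : ζ ^ n = -1) {z : ℂ} (hz : z ∈ disk) :
    (z ^ n - 1) / (z ^ n + 1) = ∑ j ∈ Finset.range n, ((1 / n : ℝ) : ℂ) *
      ((ζ * rootUnity n ^ j * z + 1) / (ζ * rootUnity n ^ j * z - 1)) := by
  have hn' : (n : ℂ) ≠ 0 := by exact_mod_cast hn
  have hz1 := add_one_ne_zero_of_mem_disk (pow_mem_disk hz hn)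
  have hterm : ∀ j, (ζ * rootUnity n ^ j * z + 1) / (ζ * rootUnity n ^ j * z - 1) =
      1 - 2 / (z ^ n + 1) * ∑ i ∈ Finset.range n, z ^ i * (ζ * rootUnity n ^ j) ^ i := fun j => by
    have hw := mul_mem_disk (norm_eq_one_of_pow_eq_neg_one hn (root_pow hn hζ j)).le hz
    have h1 : ζ * rootUnity n ^ j * z - 1 ≠ 0 := by
      rw [← neg_sub, neg_ne_zero]
      exact one_sub_ne_zero_of_mem_disk hw
    have h2 := mul_geom_sum (ζ * rootUnity n ^ j * z) n
    rw [mul_pow _ z n, root_pow hn hζ j] at h2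
    have h3 : ∑ i ∈ Finset.range n, z ^ i * (ζ * rootUnity n ^ j) ^ i =
        ∑ i ∈ Finset.range n, (ζ * rootUnity n ^ j * z) ^ i :=
      Finset.sum_congr rfl fun i _ => by ring
    rw [h3, div_eq_iff h1]
    field_simp
    linear_combination 2 * h2
  have hdouble : ∑ j ∈ Finset.range n, ∑ i ∈ Finset.range n, z ^ i * (ζ * rootUnity n ^ j) ^ i =
      n := by
    rw [Finset.sum_comm]
    simp only [← Finset.mul_sum, sum_root_pow hn]
    rw [Finset.sum_eq_single_of_mem 0 (by simp; omega)]
    · simp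
    · intro k hk hk0
      rw [if_neg (Nat.not_dvd_of_pos_of_lt (by omega) (Finset.mem_range.1 hk)), mul_zero]
  rw [← Finset.mul_sum]
  simp only [hterm]
  rw [Finset.sum_sub_distrib, ← Finset.mul_sum, hdouble]
  simp only [Finset.sum_const, Finset.card_range, nsmul_eq_mul, mul_one]
  push_cast
  field_simp
  ring

lemma exists_isAtomicRep {n : ℕ} (hn : n ≠ 0) {f : ℂ → ℂ} (h : EqOn f (krzyzFun n) disk) :
    ∃ (r : Fin n → ℝ) (α : Fin n → ℂ), IsAtomicRep f n r α ∧ ∀ i j, r i = r j := by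
  obtain ⟨ζ, hζ⟩ := exists_pow_eq_neg_one hn
  have hζ0 : ζ ≠ 0 := by
    rintro rfl
    simp [hn] at hζ
  refine ⟨fun _ => 1 / n, fun j => ζ * rootUnity n ^ (j : ℕ),
    ⟨fun _ => by positivity, fun j => norm_eq_one_of_pow_eq_neg_one hn (root_pow hn hζ j), ?_,
      fun z hz => ?_⟩, fun _ _ => rfl⟩
  · intro i j hij
    exact Fin.ext ((isPrimitiveRoot_rootUnity hn).pow_inj i.2 j.2 (mul_left_cancel₀ hζ0 hij))
  · rw [h hz, krzyzFun, krzyzLog_eq_sum hn hζ hz, Finset.sum_range]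

/-! ### The conditions on the Wiener transform -/

lemma wiener_eq_of_eqOn_pow {n : ℕ} (hn : n ≠ 0) {f h : ℂ → ℂ}
    (hf : EqOn f (fun z => h (z ^ n)) disk) : EqOn (wiener n f) f disk := by
  intro z hz
  have hn' : (n : ℂ) ≠ 0 := by exact_mod_cast hn
  rw [wiener_eq, Finset.sum_congr rfl (g := fun _ => f z) fun j _ => by
    rw [hf (mul_mem_disk (norm_rootUnity_pow hn j).le hz), hf hz]
    simp only [mul_pow, rootUnity_pow_pow hn, one_mul]]
  simp only [Finset.sum_const, Finset.card_range, nsmul_eq_mul]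
  field_simp

lemma coeff_eq_zero_of_eqOn_wiener {n : ℕ} {f : ℂ → ℂ} (hf : DifferentiableOn ℂ f disk)
    (h : EqOn (wiener n f) f disk) {k : ℕ} (hk1 : 1 ≤ k) (hk : k < n) : coeff f k = 0 := by
  rw [← coeff_congr h, coeff_wiener (by omega) hf, if_neg (Nat.not_dvd_of_pos_of_lt hk1 hk)]

/-- A zero-free `W_n f` yields a normalized function `H_f` with `a_n` as its first coefficient, and
the first coefficient is at most `2te^{-t}` where `a_0 = e^{-t}`. -/
lemma IsExtremal.coeff_eq_of_wiener_ne_zero {n : ℕ} (hn : n ≠ 0) {f : ℂ → ℂ}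
    (hf : IsExtremal n f) (h : ∀ z ∈ disk, wiener n f z ≠ 0) :
    coeff f n = 2 * coeff f 0 := by
  have hfd := hf.1.1.1
  have hfb : ∀ z ∈ disk, ‖f z‖ ≤ 1 := fun z hz => (hf.1.1.2 z hz).2
  have hsum : ∀ z ∈ disk, _ := fun z hz => hasSum_wienerH n hfd hfb hz
  have hc := coeff_eq_of_hasSum hsum
  have hnorm : Normalized (wienerH n f) := by
    refine ⟨⟨differentiableOn_of_hasSum hsum, fun z hz => ?_⟩, ?_, ?_⟩
    · obtain ⟨w, hw, rfl⟩ := exists_pow_eq_mem_disk hn hz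
      rw [wienerH_pow hn hfd hfb hw]
      exact ⟨norm_pos_iff.2 (h w hw), norm_wiener_le_one hn hfb hw⟩
    · rw [hc]; exact hf.1.2.1
    · rw [hc]; exact hf.1.2.2
  obtain ⟨G, hG, hGe, t, ht⟩ := hnorm.exists_log
  have h0 : coeff f 0 = (Real.exp (-t) : ℂ) := by
    rw [← mul_zero n, ← hc 0, coeff_zero, hGe 0 zero_mem_disk, ← coeff_zero G, ht]
    simp
  have h1 : coeff f n = coeff f 0 * coeff G 1 := by
    have := recursion_of_exp hG hGe 1 1 le_rfl le_rfl
    simpa [hc] using this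
  refine hf.coeff_eq_of_le hn h0 ?_
  rw [h1, h0, Complex.re_ofReal_mul, mul_comm]
  gcongr
  exact (Complex.re_le_norm _).trans
    (norm_coeff_le_two_mul hG (hnorm.1.re_le hGe) ht one_ne_zero)

/-- A Blaschke product of value `1` at the origin has no zeros, since its value there has modulus
`∏ |w_i|`; so it is constant. -/
lemma IsBlaschke.eq_one {B : ℂ → ℂ} (hB : IsBlaschke B) (h : B 0 = 1) :
    ∀ z ∈ disk, B z = 1 := by
  obtain ⟨γ, m, ι, w, hγ, hw, -, hp⟩ := hB
  obtain ⟨p, hp0, hBp⟩ := hp 0 zero_mem_disk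
  have hm : m = 0 := by
    by_contra hm
    rw [h] at hBp
    simp [hm] at hBp
  subst hm
  have hp1 : ‖p‖ = 1 := by
    have := congrArg norm hBp
    rw [h] at this
    simpa [hγ] using this.symm
  have hι : IsEmpty ι := by
    classical
    refine ⟨fun i => ?_⟩
    have h1 : HasProd (fun i => ‖w i‖) 1 := by
      have := hp0.norm
      rw [hp1] at this
      convert! this using 2 with i
      have := norm_ne_zero_iff.2 (hw i).1
      simp [this]
    have h2 : (1 : ℝ) ≤ ‖w i‖ := by
      refine le_of_tendsto (x := atTop) h1 ?_
      filter_upwards [eventually_ge_atTop {i}] with s hs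
      rw [← Finset.mul_prod_erase s _ (Finset.singleton_subset_iff.1 hs)]
      exact mul_le_of_le_one_right (norm_nonneg _)
        (Finset.prod_le_one (fun _ _ => norm_nonneg _) fun j _ => (hw j).2.le)
    exact absurd (hw i).2 (not_lt.2 h2)
  have hB' : ∀ z ∈ disk, B z = γ := fun z hz => by
    obtain ⟨q, hq, hBq⟩ := hp z hz
    have : q = 1 := hq.unique hasProd_empty
    simpa [this] using hBq
  intro z hz
  rw [hB' z hz, ← hB' 0 zero_mem_disk, h]

lemma isBlaschke_one : IsBlaschke fun _ => 1 :=
  ⟨1, 0, Empty, fun i => i.elim, by simp, fun i => i.elim, summable_empty,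
    fun z _ => ⟨1, hasProd_empty, by simp⟩⟩

lemma wiener_ne_zero_of_isRieszFactorization {n : ℕ} (hn : n ≠ 0) {f B G : ℂ → ℂ} (hf : BStar f)
    (h : IsRieszFactorization (wienerH n f) B G) (hB : B 0 = 1) {z : ℂ} (hz : z ∈ disk) :
    wiener n f z ≠ 0 := by
  obtain ⟨hBl, -, -, -, hG, hBG, -⟩ := h
  have hzn := pow_mem_disk hz hn
  rw [← wienerH_pow hn hf.1 (fun z hz => (hf.2 z hz).2) hz, hBG _ hzn, hBl.eq_one hB _ hzn, one_mul]
  exact hG _ hzn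

lemma exists_isRieszFactorization {n : ℕ} (hn : n ≠ 0) {f : ℂ → ℂ} (hf : BStar f)
    (h : ∀ z ∈ disk, wiener n f z ≠ 0) :
    ∃ B G : ℂ → ℂ, IsRieszFactorization (wienerH n f) B G ∧ B 0 = 1 := by
  have hfb : ∀ z ∈ disk, ‖f z‖ ≤ 1 := fun z hz => (hf.2 z hz).2
  refine ⟨fun _ => 1, wienerH n f, ⟨isBlaschke_one, by simp, by simp,
    differentiableOn_of_hasSum fun z hz => hasSum_wienerH n hf.1 hfb hz, fun z hz => ?_,
    fun z _ => (one_mul _).symm, fun z hz => ?_, rfl⟩, rfl⟩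
  · obtain ⟨w, hw, rfl⟩ := exists_pow_eq_mem_disk hn hz
    rw [wienerH_pow hn hf.1 hfb hw]
    exact h w hw
  · obtain ⟨w, hw, rfl⟩ := exists_pow_eq_mem_disk hn hz
    rw [wienerH_pow hn hf.1 hfb hw]
    exact norm_wiener_le_one hn hfb hw

/-! ### The zeros of `P` -/

lemma coeff_P (n : ℕ) (f : ℂ → ℂ) (k : ℕ) :
    (P n f).coeff k = if k = 0 then coeff f n else if k ≤ n then 2 * coeff f (n - k) else 0 := by
  rw [P, Polynomial.coeff_add, Polynomial.coeff_C, Polynomial.finsetSum_coeff]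
  simp only [Polynomial.coeff_C_mul, Polynomial.coeff_X_pow, mul_ite, mul_one, mul_zero]
  rw [Finset.sum_ite_eq]
  rcases Nat.eq_zero_or_pos k with rfl | hk
  · simp
  · simp [hk.ne', Nat.one_le_iff_ne_zero]

lemma natDegree_P {n : ℕ} {f : ℂ → ℂ} (h : coeff f 0 ≠ 0) (hn : n ≠ 0) :
    (P n f).natDegree = n := by
  refine Polynomial.natDegree_eq_of_le_of_coeff_ne_zero ?_ ?_
  · rw [Polynomial.natDegree_le_iff_coeff_eq_zero]
    intro k hk
    rw [coeff_P, if_neg (by omega), if_neg (by omega)]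
  · rw [coeff_P, if_neg hn, if_pos le_rfl, Nat.sub_self]
    simpa using h

/-- Vieta's formula. -/
lemma coeff_eq_prod_roots {n : ℕ} {f : ℂ → ℂ} (h : coeff f 0 ≠ 0) (hn : n ≠ 0) :
    coeff f n = 2 * coeff f 0 * ((-1) ^ n * (P n f).roots.prod) := by
  have h1 := (IsAlgClosed.splits (P n f)).coeff_zero_eq_leadingCoeff_mul_prod_roots
  rw [Polynomial.leadingCoeff, natDegree_P h hn, coeff_P, if_pos rfl, coeff_P, if_neg hn,
    if_pos le_rfl, Nat.sub_self] at h1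
  rw [h1]
  ring

lemma roots_P_eq_nthRoots {n : ℕ} (hn : n ≠ 0) {f : ℂ → ℂ} (h : coeff f 0 ≠ 0)
    (ha : coeff f n = 2 * coeff f 0) (hb : ∀ k, 1 ≤ k → k < n → coeff f k = 0) :
    (P n f).roots = Polynomial.nthRoots n (-1) := by
  have : P n f = Polynomial.C (2 * coeff f 0) * (Polynomial.X ^ n - Polynomial.C (-1)) := by
    ext k
    rw [coeff_P, Polynomial.coeff_C_mul, Polynomial.coeff_sub, Polynomial.coeff_X_pow,
      Polynomial.coeff_C]
    rcases Nat.eq_zero_or_pos k with rfl | hk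
    · simp [hn.symm, ha]
    · rw [if_neg hk.ne', if_neg hk.ne']
      rcases lt_trichotomy k n with h1 | rfl | h1
      · rw [if_pos h1.le, if_neg h1.ne, hb _ (by omega) (by omega)]
        simp
      · simp
      · rw [if_neg (by omega), if_neg h1.ne']
        simp
  rw [this, Polynomial.roots_C_mul _ (by simpa using h), Polynomial.nthRoots]

/-! ### The remaining sufficient conditions -/

lemma IsExtremal.coeff_eq_of_eqOn_cayley {n k : ℕ} (hn : n ≠ 0) {f g H : ℂ → ℂ}
    (hf : IsExtremal n f) (hg : IsNormalizedLog f g) (hH : DifferentiableOn ℂ H disk)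
    (hb : ∀ z ∈ disk, ‖H z‖ ≤ 1) (hk : n ≤ 2 * k)
    (h : ∀ z ∈ disk, g z = (z ^ k * H z - 1) / (z ^ k * H z + 1)) :
    coeff f n = 2 * coeff f 0 := by
  have hk0 : k ≠ 0 := by omega
  have hfe : EqOn f (fun z => Complex.exp ((z ^ k * H z - 1) / (z ^ k * H z + 1))) disk :=
    fun z hz => by rw [hg.2.1 z hz, h z hz]
  have h0 : coeff f 0 = (Real.exp (-1) : ℂ) := by
    rw [coeff_zero, hfe zero_mem_disk]
    simp [hk0]
  refine hf.coeff_eq_of_le hn h0 ?_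
  have hφ : ‖coeff (fun z => z ^ k * H z) n‖ ≤ 1 :=
    norm_coeff_le (by fun_prop) (fun z hz => (mem_disk.1 (pow_mul_mem_disk hb hk0 hz)).le) n
  rw [coeff_congr hfe, coeff_exp_krzyzLog_comp hH hb hn (by omega)]
  have h2 : (2 : ℂ) * Complex.exp (-1) = ((2 * Real.exp (-1) : ℝ) : ℂ) := by push_cast; rfl
  rw [h2, Complex.re_ofReal_mul]
  nlinarith [Complex.re_le_norm (coeff (fun z => z ^ k * H z) n), Real.exp_pos (-1)]

/-- If `Re b_n = 2|b_0|`, all atoms `α_j` satisfy `α_j^n = -1`. As there are `n` of them, with equal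
weights, the sums `∑ α_j^k` vanish for `1 ≤ k < n`. -/
lemma coeff_eq_zero_of_isAtomicRep {n : ℕ} {f g : ℂ → ℂ} (hg : IsNormalizedLog f g)
    {r : Fin n → ℝ} {α : Fin n → ℂ} (h : IsAtomicRep f n r α) (hr : ∀ i j, r i = r j)
    (hre : (coeff g n).re = 2 * ‖coeff g 0‖) {k : ℕ} (hk1 : 1 ≤ k) (hk : k < n) :
    coeff g k = 0 := by
  have hn : n ≠ 0 := by omega
  obtain ⟨hrpos, hα, hinj, hfe⟩ := h
  obtain ⟨t, ht, hg0, hf0⟩ := hg.exists_pos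
  set S : ℂ → ℂ := fun z => ∑ j, (r j : ℂ) * ((α j * z + 1) / (α j * z - 1)) with hS
  have hterm : ∀ z ∈ disk, ∀ j, HasSum (fun i : ℕ => (r j : ℂ) *
      ((if i = 0 then -1 else -2 * α j ^ i) * z ^ i))
      ((r j : ℂ) * ((α j * z + 1) / (α j * z - 1))) := fun z hz j => by
    have := hasSum_coeff (differentiableOn_add_one_div_sub_one (hα j)) hz
    simp only [coeff_add_one_div_sub_one (hα j)] at this
    exact this.mul_left _
  have hsum : ∀ z ∈ disk, HasSum (fun i : ℕ =>
      (∑ j, (r j : ℂ) * (if i = 0 then -1 else -2 * α j ^ i)) * z ^ i) (S z) := fun z hz => by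
    simpa [Finset.sum_mul, mul_assoc] using hasSum_sum fun j (_ : j ∈ Finset.univ) => hterm z hz j
  have hSd := differentiableOn_of_hasSum hsum
  have hSc := coeff_eq_of_hasSum hsum
  have hS0 : S 0 = -((∑ j, r j : ℝ) : ℂ) := by
    rw [← coeff_zero S, hSc]
    simp
  have hgS : EqOn g S disk := by
    refine eqOn_of_exp_eq hg.1 hSd (fun z hz => by rw [← hg.2.1 z hz, hfe z hz]) ?_
    have h1 := hfe 0 zero_mem_disk
    change f 0 = Complex.exp (S 0) at h1
    rw [← coeff_zero f, hf0, hS0, ← Complex.ofReal_neg, ← Complex.ofReal_exp] at h1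
    rw [← coeff_zero g, hg0, hS0, ← Complex.ofReal_neg, ← Complex.ofReal_neg,
      Real.exp_injective (Complex.ofReal_injective h1)]
  have hgc : ∀ i, coeff g i = ∑ j, (r j : ℂ) * (if i = 0 then -1 else -2 * α j ^ i) := fun i => by
    rw [coeff_congr hgS, hSc]
  have htr : t = ∑ j, r j := by
    have h1 := coeff_zero g
    rw [hgS zero_mem_disk, hS0, hg0] at h1
    exact_mod_cast neg_injective h1
  have hroot : ∀ j, α j ^ n = -1 := by
    have h1 : ∑ j, r j * (1 + (α j ^ n).re) = 0 := by
      rw [hg0, norm_neg, Complex.norm_real, Real.norm_of_nonneg ht.le, hgc n, Complex.re_sum] at hre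
      simp only [if_neg hn, Complex.re_ofReal_mul] at hre
      simp only [mul_add, mul_one, Finset.sum_add_distrib, ← htr]
      have h2 : ∑ j, r j * (-2 * α j ^ n).re = -2 * ∑ j, r j * (α j ^ n).re := by
        rw [Finset.mul_sum]
        refine Finset.sum_congr rfl fun j _ => ?_
        simp
        ring
      linarith
    have hnorm : ∀ j, ‖α j ^ n‖ = 1 := fun j => by rw [norm_pow, hα j, one_pow]
    have hge : ∀ j, 0 ≤ 1 + (α j ^ n).re := fun j => by
      have := (abs_le.1 ((Complex.abs_re_le_norm _).trans (hnorm j).le)).1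
      linarith
    intro j
    have h3 := (Finset.sum_eq_zero_iff_of_nonneg fun j _ =>
      mul_nonneg (hrpos j).le (hge j)).1 h1 j (Finset.mem_univ j)
    have h4 : (α j ^ n).re = -1 := by
      have := (mul_eq_zero.1 h3).resolve_left (hrpos j).ne'
      linarith
    have h5 := hnorm j
    rw [← sq_eq_sq₀ (norm_nonneg _) zero_le_one, ← Complex.normSq_eq_norm_sq,
      Complex.normSq_apply, h4] at h5
    refine Complex.ext (by simpa using h4) ?_
    simp only [Complex.neg_im, Complex.one_im, neg_zero]
    nlinarith
  have himage : Finset.univ.image α = (Polynomial.nthRoots n (-1 : ℂ)).toFinset := by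
    refine Finset.eq_of_subset_of_card_le (fun x hx => ?_) ?_
    · obtain ⟨j, -, rfl⟩ := Finset.mem_image.1 hx
      rw [Multiset.mem_toFinset, Polynomial.mem_nthRoots (Nat.pos_of_ne_zero hn)]
      exact hroot j
    · rw [Finset.card_image_of_injective _ hinj, Finset.card_univ, Fintype.card_fin]
      exact (Multiset.toFinset_card_le _).trans (Polynomial.card_nthRoots _ _)
  have hpow : ∑ j, α j ^ k = 0 := by
    have h1 : ∑ j, α j ^ k = ∑ x ∈ (Polynomial.nthRoots n (-1 : ℂ)).toFinset, x ^ k := by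
      rw [← himage, Finset.sum_image fun a _ b _ h => hinj h]
    have hω := isPrimitiveRoot_rootUnity hn
    have hω0 : rootUnity n ≠ 0 := hω.ne_zero hn
    have hωn : rootUnity n ^ n = 1 := hω.pow_eq_one
    have h2 : ∑ x ∈ (Polynomial.nthRoots n (-1 : ℂ)).toFinset, x ^ k =
        ∑ x ∈ (Polynomial.nthRoots n (-1 : ℂ)).toFinset, (rootUnity n * x) ^ k := by
      refine (Finset.sum_bij (fun x _ => rootUnity n * x) (fun x hx => ?_)
        (fun x _ y _ h => mul_left_cancel₀ hω0 h) (fun y hy => ⟨(rootUnity n)⁻¹ * y, ?_, ?_⟩)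
        fun x _ => rfl).symm
      · rw [Multiset.mem_toFinset, Polynomial.mem_nthRoots (Nat.pos_of_ne_zero hn)] at hx ⊢
        rw [mul_pow, hωn, hx, one_mul]
      · rw [Multiset.mem_toFinset, Polynomial.mem_nthRoots (Nat.pos_of_ne_zero hn)] at hy ⊢
        rw [mul_pow, inv_pow, hωn, hy, inv_one, one_mul]
      · rw [mul_inv_cancel_left₀ hω0]
    rw [← h1] at h2
    simp only [mul_pow, ← Finset.mul_sum] at h2
    rw [← h1] at h2
    have h3 : rootUnity n ^ k ≠ 1 := fun h =>
      Nat.not_dvd_of_pos_of_lt hk1 hk ((hω.pow_eq_one_iff_dvd k).1 h)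
    exact ((mul_left_eq_self₀.1 h2.symm).resolve_left h3)
  rw [hgc]
  simp only [if_neg (show k ≠ 0 by omega)]
  have hrc : ∀ j, r j = r ⟨0, by omega⟩ := fun j => hr _ _
  rw [Finset.sum_congr rfl (g := fun j => (r ⟨0, by omega⟩ : ℂ) * -2 * α j ^ k) fun j _ => by
    rw [hrc j]; ring, ← Finset.mul_sum, hpow, mul_zero]

/-! ### Existence of an extremal function -/

lemma Recursion.norm_le {n : ℕ} {a b : ℕ → ℂ} (h : Recursion n a b) {c : ℝ} (hc : 0 ≤ c)
    (hb : ∀ k, 1 ≤ k → ‖b k‖ ≤ c) : ∀ m ≤ n, ‖a m‖ ≤ (1 + c) ^ m * ‖a 0‖ := by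
  intro m
  induction m using Nat.strong_induction_on with
  | _ m ih =>
    intro hmn
    rcases Nat.eq_zero_or_pos m with rfl | hm
    · simp
    have hm' : (0 : ℝ) < m := by exact_mod_cast hm
    rw [h m hm hmn]
    have hterm : ∀ j ∈ Finset.Icc 1 m, ‖(j : ℂ) / (m : ℂ) * a (m - j) * b j‖ ≤
        (1 + c) ^ (m - j) * ‖a 0‖ * c := fun j hj => by
      have hj' := Finset.mem_Icc.1 hj
      rw [norm_mul, norm_mul, norm_div, Complex.norm_natCast, Complex.norm_natCast]
      have h1 : (j : ℝ) / m ≤ 1 := div_le_one_of_le₀ (by exact_mod_cast hj'.2) hm'.le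
      have h2 := ih (m - j) (by omega) (by omega)
      have h3 := hb j hj'.1
      calc _ ≤ 1 * ((1 + c) ^ (m - j) * ‖a 0‖) * c := by gcongr
        _ = _ := by ring
    refine (norm_sum_le_of_le _ hterm).trans ?_
    rw [← Finset.sum_mul, ← Finset.sum_mul]
    have hre : ∑ j ∈ Finset.Icc 1 m, (1 + c) ^ (m - j) = ∑ i ∈ Finset.range m, (1 + c) ^ i := by
      rw [← Finset.sum_range_reflect, ← Finset.Ico_succ_right_eq_Icc, Order.succ_eq_add_one,
        ← zero_add 1, ← Finset.sum_Ico_add', Finset.range_eq_Ico]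
      exact Finset.sum_congr rfl fun j _ => by congr 1; omega
    have hgeom := mul_geom_sum (1 + c) m
    rw [add_sub_cancel_left] at hgeom
    calc _ = (c * ∑ i ∈ Finset.range m, (1 + c) ^ i) * ‖a 0‖ := by rw [hre]; ring
      _ = ((1 + c) ^ m - 1) * ‖a 0‖ := by rw [hgeom]
      _ ≤ _ := by
        gcongr
        linarith

/-- The sum of the power series with coefficients `b`. -/
noncomputable def powerSum (b : ℕ → ℂ) (z : ℂ) : ℂ := ∑' k, b k * z ^ k

/-- The coefficient sequences of the functions `g` with `Re g ≤ 0`, `g(0)` real, cut off by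
`|b_k| ≤ 2K`. It is a compact subset of the product space. -/
def logCoeffs (K : ℝ) : Set (ℕ → ℂ) :=
  {b | (∀ k, ‖b k‖ ≤ 2 * K) ∧ (b 0).im = 0 ∧ ∀ z ∈ disk, (powerSum b z).re ≤ 0}

lemma hasSum_powerSum {b : ℕ → ℂ} {C : ℝ} (hb : ∀ k, ‖b k‖ ≤ C) {z : ℂ} (hz : z ∈ disk) :
    HasSum (fun k => b k * z ^ k) (powerSum b z) := by
  refine Summable.hasSum ?_
  refine Summable.of_norm_bounded (g := fun k => C * ‖z‖ ^ k)
    ((summable_geometric_of_lt_one (norm_nonneg _) (mem_disk.1 hz)).mul_left C) fun k => ?_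
  rw [norm_mul, norm_pow]
  gcongr
  exact hb k

lemma continuousOn_powerSum (C : ℝ) {z : ℂ} (hz : z ∈ disk) :
    ContinuousOn (fun b => powerSum b z) (univ.pi fun _ : ℕ => closedBall (0 : ℂ) C) := by
  refine continuousOn_tsum (u := fun k => C * ‖z‖ ^ k) (fun k => by fun_prop)
    ((summable_geometric_of_lt_one (norm_nonneg _) (mem_disk.1 hz)).mul_left C) fun k b hb => ?_
  rw [norm_mul, norm_pow]
  gcongr
  simpa using hb k (mem_univ k)

lemma isCompact_logCoeffs (K : ℝ) : IsCompact (logCoeffs K) := by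
  have hc : IsCompact (univ.pi fun _ : ℕ => closedBall (0 : ℂ) (2 * K)) :=
    isCompact_univ_pi fun _ => isCompact_closedBall _ _
  have heq : logCoeffs K = (univ.pi fun _ : ℕ => closedBall (0 : ℂ) (2 * K)) ∩
      ({b | (b 0).im = 0} ∩ ⋂ z ∈ disk, ((univ.pi fun _ : ℕ => closedBall (0 : ℂ) (2 * K)) ∩
        (fun b => powerSum b z) ⁻¹' {w | w.re ≤ 0})) := by
    ext b
    simp only [logCoeffs, mem_ofPred_eq, mem_inter_iff, mem_univ_pi, mem_closedBall_zero_iff,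
      mem_iInter, mem_preimage]
    exact ⟨fun h => ⟨h.1, h.2.1, fun z hz => ⟨h.1, h.2.2 z hz⟩⟩,
      fun h => ⟨h.1, h.2.1, fun z hz => (h.2.2 z hz).2⟩⟩
  rw [heq]
  refine hc.inter_right (IsClosed.inter ?_ (isClosed_biInter fun z hz => ?_))
  · exact isClosed_eq (Complex.continuous_im.comp (continuous_apply 0)) continuous_const
  · exact (continuousOn_powerSum _ hz).preimage_isClosed_of_isClosed hc.isClosed
      (isClosed_le Complex.continuous_re continuous_const)

lemma coeff_powerSum {b : ℕ → ℂ} {C : ℝ} (hb : ∀ k, ‖b k‖ ≤ C) (k : ℕ) :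
    coeff (powerSum b) k = b k :=
  coeff_eq_of_hasSum (fun _ hz => hasSum_powerSum hb hz) k

lemma differentiableOn_powerSum {b : ℕ → ℂ} {C : ℝ} (hb : ∀ k, ‖b k‖ ≤ C) :
    DifferentiableOn ℂ (powerSum b) disk :=
  differentiableOn_of_hasSum fun _ hz => hasSum_powerSum hb hz

lemma coeff_mem_logCoeffs {g : ℂ → ℂ} (hg : DifferentiableOn ℂ g disk)
    (hre : ∀ z ∈ disk, (g z).re ≤ 0) {t K : ℝ} (h0 : coeff g 0 = -t) (ht : t ≤ K) :
    coeff g ∈ logCoeffs K := by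
  have ht0 : 0 ≤ t := by
    have := hre 0 zero_mem_disk
    rw [← coeff_zero g, h0] at this
    simpa using this
  refine ⟨fun k => ?_, by simp [h0], fun z hz => ?_⟩
  · rcases Nat.eq_zero_or_pos k with rfl | hk
    · rw [h0, norm_neg, Complex.norm_real, Real.norm_of_nonneg ht0]
      linarith
    · exact (norm_coeff_le_two_mul hg hre h0 hk.ne').trans (by linarith)
  · rw [powerSum, (hasSum_coeff hg hz).tsum_eq]
    exact hre z hz

/-- By the recursion, the `m`-th coefficient of `e^g` is a polynomial in those of `g`, with
`e^{b_0}` as a factor. -/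
lemma continuousOn_coeff_exp (K : ℝ) (m : ℕ) :
    ContinuousOn (fun b => coeff (fun z => Complex.exp (powerSum b z)) m) (logCoeffs K) := by
  induction m using Nat.strong_induction_on with
  | _ m ih =>
    rcases Nat.eq_zero_or_pos m with rfl | hm
    · refine ContinuousOn.congr (f := fun b => Complex.exp (b 0)) (by fun_prop) fun b hb => ?_
      simp only [coeff_zero]
      rw [← coeff_zero (powerSum b), coeff_powerSum hb.1]
    · refine ContinuousOn.congr (f := fun b => ∑ j ∈ Finset.Icc 1 m, (j : ℂ) / (m : ℂ) *
        coeff (fun z => Complex.exp (powerSum b z)) (m - j) * b j) ?_ fun b hb => ?_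
      · refine continuousOn_finsetSum _ fun j hj => ?_
        have hj' := Finset.mem_Icc.1 hj
        exact (continuousOn_const.mul (ih (m - j) (by omega))).mul (by fun_prop)
      · have := recursion_of_exp (f := fun z => Complex.exp (powerSum b z))
          (differentiableOn_powerSum hb.1) (fun _ _ => rfl) m m hm le_rfl
        simp only [coeff_powerSum hb.1] at this
        exact this

lemma exists_bound_pow_mul_exp (n : ℕ) :
    ∃ K : ℝ, 1 ≤ K ∧ ∀ t, K ≤ t → (1 + 2 * t) ^ n * Real.exp (-t) ≤ 2 * Real.exp (-1) := by
  have h := (Real.tendsto_pow_mul_exp_neg_atTop_nhds_zero n).const_mul (3 ^ n)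
  rw [mul_zero] at h
  have h2 := (h.eventually_le_const (show (0 : ℝ) < 2 * Real.exp (-1) by positivity))
  obtain ⟨K, hK⟩ := eventually_atTop.1 h2
  refine ⟨max K 1, le_max_right _ _, fun t ht => ?_⟩
  have h1 : 1 ≤ t := (le_max_right _ _).trans ht
  calc _ ≤ (3 * t) ^ n * Real.exp (-t) := by gcongr; linarith
    _ = 3 ^ n * (t ^ n * Real.exp (-t)) := by rw [mul_pow]; ring
    _ ≤ _ := hK t ((le_max_left _ _).trans ht)

/-- The maximum of `Re a_n` over the logarithms with `|b_0| ≤ K` exists by compactness; for large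
`|b_0|` the coefficient `a_n` is at most `(1 + 2|b_0|)^n e^{b_0}`, which is small. -/
theorem exists_isExtremal {n : ℕ} (hn : n ≠ 0) : ∃ f, IsExtremal n f := by
  obtain ⟨K, hK1, hK⟩ := exists_bound_pow_mul_exp n
  set Φ : (ℕ → ℂ) → ℝ := fun b => (coeff (fun z => Complex.exp (powerSum b z)) n).re with hΦ
  have hmem := coeff_mem_logCoeffs (differentiableOn_krzyzLog_pow hn)
    (fun z hz => re_sub_one_div_add_one_nonpos (mem_disk.1 (pow_mem_disk hz hn)).le)
    (t := 1) (by simp [coeff_zero, hn]) hK1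
  obtain ⟨b, hb, hmax⟩ := (isCompact_logCoeffs K).exists_isMaxOn ⟨_, hmem⟩
    (Complex.continuous_re.comp_continuousOn (continuousOn_coeff_exp K n))
  have hΦeq : ∀ {h g : ℂ → ℂ}, DifferentiableOn ℂ g disk →
      (∀ z ∈ disk, h z = Complex.exp (g z)) → Φ (coeff g) = (coeff h n).re := by
    intro h g hg he
    simp only [hΦ]
    rw [coeff_congr (f := h) (g := fun z => Complex.exp (powerSum (coeff g) z)) fun z hz => ?_]
    simp only [he z hz, powerSum, (hasSum_coeff hg hz).tsum_eq]
  refine ⟨fun z => Complex.exp (powerSum b z),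
    normalized_of_exp (differentiableOn_powerSum hb.1) hb.2.2 ?_, fun h hh => ?_⟩
  · rw [← coeff_zero (powerSum b), coeff_powerSum hb.1]
    exact hb.2.1
  · obtain ⟨g, hg, he, t, ht⟩ := hh.exists_log
    have hre := hh.1.re_le he
    rcases le_total t K with htK | htK
    · rw [← hΦeq hg he]
      exact hmax (coeff_mem_logCoeffs hg hre ht htK)
    · have h1 := (recursion_of_exp hg he n).norm_le (c := 2 * t) (by linarith)
        (fun k hk => norm_coeff_le_two_mul hg hre ht (by omega)) n le_rfl
      have h2 : ‖coeff h 0‖ = Real.exp (-t) := by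
        rw [coeff_zero, he 0 zero_mem_disk, ← coeff_zero g, ht, Complex.norm_exp]
        simp
      rw [h2] at h1
      have h3 : (2 : ℝ) * Real.exp (-1) = Φ (coeff fun z => (z ^ n - 1) / (z ^ n + 1)) := by
        rw [hΦeq (h := krzyzFun n) (differentiableOn_krzyzLog_pow hn) fun z _ => rfl,
          coeff_krzyzFun_self hn, show (2 : ℂ) * Complex.exp (-1) =
            ((2 * Real.exp (-1) : ℝ) : ℂ) by push_cast; rfl, Complex.ofReal_re]
      calc _ ≤ ‖coeff h n‖ := Complex.re_le_norm _
        _ ≤ _ := h1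
        _ ≤ _ := hK t htK
        _ = _ := h3
        _ ≤ _ := hmax hmem

/-- If the extremal function is unique, it is invariant under the rotation by `e^{2πi/n}`. -/
lemma coeff_eq_zero_of_uniqueExtremal {n : ℕ} (h : UniqueExtremal n) {f : ℂ → ℂ}
    (hf : IsExtremal n f) {k : ℕ} (hk1 : 1 ≤ k) (hk : k < n) : coeff f k = 0 := by
  have hn : n ≠ 0 := by omega
  obtain ⟨f₀, -, huniq⟩ := h
  have hω := norm_rootUnity hn
  have hfd := hf.1.1.1
  have hc := coeff_comp_mul hω.le hfd
  have hrot : IsExtremal n fun z => f (rootUnity n * z) := by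
    refine ⟨⟨⟨differentiableOn_comp_mul hω.le hfd,
      fun z hz => hf.1.1.2 _ (mul_mem_disk hω.le hz)⟩, ?_⟩, fun h hh => ?_⟩
    · rw [hc, pow_zero, one_mul]
      exact hf.1.2
    · rw [hc, (isPrimitiveRoot_rootUnity hn).pow_eq_one, one_mul]
      exact hf.2 h hh
  have heq : EqOn (fun z => f (rootUnity n * z)) f disk :=
    (huniq _ hrot).trans (huniq _ hf).symm
  have h1 := hc k
  rw [coeff_congr heq] at h1
  refine (mul_left_eq_self₀.1 h1.symm).resolve_left fun h2 => ?_
  exact Nat.not_dvd_of_pos_of_lt hk1 hk (((isPrimitiveRoot_rootUnity hn).pow_eq_one_iff_dvd k).1 h2)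

/-! ### The equivalences -/

/-- The seventeen conditions are equivalent; all are compared with `f = krzyzFun n`. -/
theorem conditions_tfae {n : ℕ} (hn : 2 ≤ n) {f g : ℂ → ℂ} (hf : IsExtremal n f)
    (hg : IsNormalizedLog f g) : (conditions n f g).TFAE := by
  have hn0 : n ≠ 0 := by omega
  obtain ⟨t, ht, hg0, hf0⟩ := hg.exists_pos
  have hre := hf.1.1.re_le hg.2.1
  have hfd := hf.1.1.1
  have hrec := recursion_of_exp hg.1 hg.2.1 n
  have ha0 : coeff f 0 ≠ 0 := by rw [hf0]; exact_mod_cast (Real.exp_pos _).ne'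
  have han := hf.coeff_eq_ofReal hn0
  have hbn : (coeff g n).re ≤ 2 * t :=
    (Complex.re_le_norm _).trans (norm_coeff_le_two_mul hg.1 hre hg0 hn0)
  have hsum := hf.re_sum_Ico hn0 hg hg0 hf0
  have hpos : 0 < (coeff f n).re :=
    lt_of_lt_of_le (by positivity) (two_mul_exp_neg_one_le hn0 hf)
  have hab : (∀ k, 1 ≤ k → k < n → coeff f k = 0) ↔ (∀ k, 1 ≤ k → k < n → coeff g k = 0) :=
    hrec.left_eq_zero_iff ha0
  -- The conditions are reduced to these: vanishing coefficients, `a_n = 2 a_0`, `a_n = a_0 Re b_n`.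
  have ofB : (∀ k, 1 ≤ k → k < n → coeff f k = 0) → EqOn f (krzyzFun n) disk :=
    hf.eqOn_krzyzFun hn0 hg
  have ofA : coeff f n = 2 * coeff f 0 → EqOn f (krzyzFun n) disk := fun h =>
    ofB fun k h1 h2 => hf.coeff_eq_zero hn0 hg h h1 h2
  have ofL : coeff f n = coeff f 0 * ((coeff g n).re : ℂ) → EqOn f (krzyzFun n) disk := fun h => by
    refine ofA (hf.coeff_eq_of_le hn0 hf0 ?_)
    rw [h, hf0, Complex.re_ofReal_mul, Complex.ofReal_re, mul_comm]
    gcongr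
  have ofLc : coeff f n = coeff f 0 * coeff g n → EqOn f (krzyzFun n) disk := fun h => by
    refine ofL (Complex.ext ?_ ?_)
    · rw [h, hf0, Complex.re_ofReal_mul, Complex.re_ofReal_mul, Complex.ofReal_re]
    · rw [han, hf0, ← Complex.ofReal_mul, Complex.ofReal_im, Complex.ofReal_im]
  have hgC : EqOn f (krzyzFun n) disk → EqOn g (fun z => (z ^ n - 1) / (z ^ n + 1)) disk :=
    eqOn_krzyzLog hn0 hg
  have toA : EqOn f (krzyzFun n) disk → coeff f n = 2 * coeff f 0 :=
    coeff_eq_two_mul_of_eqOn hn0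
  have toB : EqOn f (krzyzFun n) disk → ∀ k, 1 ≤ k → k < n → coeff f k = 0 := fun h k h1 h2 => by
    rw [coeff_congr h, coeff_krzyzFun_eq_zero h1 h2]
  have toLc : EqOn f (krzyzFun n) disk → coeff f n = coeff f 0 * coeff g n := fun h =>
    hrec.eq_of_left_eq_zero hn0 (toB h)
  have toL : EqOn f (krzyzFun n) disk → coeff f n = coeff f 0 * ((coeff g n).re : ℂ) := fun h => by
    have h1 := congrArg Complex.re (toLc h)
    rw [hf0, Complex.re_ofReal_mul] at h1
    rw [han, h1, hf0, Complex.ofReal_mul]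
  have toT : EqOn f (krzyzFun n) disk → t = 1 := fun h => by
    have h1 := hgC h zero_mem_disk
    rw [← coeff_zero g, hg0] at h1
    simp only [ne_eq, hn0, not_false_eq_true, zero_pow, zero_sub, zero_add, div_one] at h1
    exact_mod_cast neg_injective h1
  have hwf : EqOn f (krzyzFun n) disk → EqOn (wiener n f) f disk := fun h =>
    wiener_eq_of_eqOn_pow hn0 (h := fun w => Complex.exp ((w - 1) / (w + 1))) h
  have toO : EqOn f (krzyzFun n) disk → ∀ z ∈ disk, wiener n f z ≠ 0 := fun h z hz => by
    rw [hwf h hz]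
    exact norm_pos_iff.1 (hf.1.1.2 z hz).1
  have ofG : (-1) ^ n * (P n f).roots.prod = 1 → coeff f n = 2 * coeff f 0 := fun h => by
    rw [coeff_eq_prod_roots ha0 hn0, h, mul_one]
  have ofH : (∀ w ∈ (P n f).roots, ‖w‖ = 1) → coeff f n = 2 * coeff f 0 := fun h => by
    have h1 := congrArg norm (coeff_eq_prod_roots (f := f) ha0 hn0)
    have h2 : ‖(P n f).roots.prod‖ = 1 := by
      have h3 : ‖(P n f).roots.prod‖ = ((P n f).roots.map norm).prod :=
        map_multiset_prod (normHom : ℂ →*₀ ℝ) _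
      rw [h3, Multiset.map_congr rfl h, Multiset.map_const', Multiset.prod_replicate, one_pow]
    rw [norm_mul, norm_mul, norm_mul, h2, norm_pow, norm_neg, norm_one, one_pow, mul_one, mul_one,
      han, hf0, Complex.norm_real, Complex.norm_real, Real.norm_of_nonneg hpos.le,
      Real.norm_of_nonneg (Real.exp_pos _).le, Complex.norm_ofNat] at h1
    rw [han, h1, hf0]
    push_cast
    rfl
  have toI : EqOn f (krzyzFun n) disk → (P n f).roots = Polynomial.nthRoots n (-1) := fun h =>
    roots_P_eq_nthRoots hn0 ha0 (toA h) (toB h)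
  have hj : coeff f n * coeff g 0 + coeff f 0 * ((coeff g n).re : ℂ) = 0 ↔
      Real.exp (-t) * (coeff g n).re = (coeff f n).re * t := by
    rw [han, hg0, hf0, Complex.ofReal_re]
    constructor
    · intro h
      have h1 : (-(coeff f n).re * t + Real.exp (-t) * (coeff g n).re : ℝ) = 0 := by
        apply Complex.ofReal_injective
        push_cast
        push_cast at h
        linear_combination h
      linarith
    · intro h
      have h1 := congrArg (fun x : ℝ => (x : ℂ)) h
      push_cast at h1
      push_cast
      linear_combination h1
  -- `a_n t = a_0 Re b_n ≤ 2 t a_0`, while `a_n ≥ 2 a_0` always holds.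
  have ofJ : Real.exp (-t) * (coeff g n).re = (coeff f n).re * t → EqOn f (krzyzFun n) disk :=
    fun h1 => by
      have h2 := hf.two_mul_coeff_zero_le hn0 hg
      have h3 : (coeff f n).re = 2 * Real.exp (-t) := by
        rw [hf0, Complex.ofReal_re] at h2
        refine le_antisymm (le_of_mul_le_mul_right ?_ ht) h2
        rw [← h1]
        nlinarith [Real.exp_pos (-t)]
      refine ofA ?_
      rw [han, h3, hf0]
      push_cast
      rfl
  refine List.tfae_of_forall (EqOn f (krzyzFun n) disk) _ ?_
  simp only [conditions, List.forall_mem_cons]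
  refine ⟨⟨ofA, toA⟩, ⟨ofB, toB⟩, trivial, ⟨fun h => ?_, fun h a b h0 hI hr => ?_⟩,
    ⟨fun h => ?_, fun h a b h0 hI hr => ?_⟩, ⟨?_, fun h => ?_⟩, ⟨fun h => ofA (ofG h), fun h => ?_⟩,
    ⟨fun h => ofA (ofH h), fun h w hw => ?_⟩, ⟨fun h => ofA (ofH fun w hw => ?_), toI⟩,
    ⟨fun h => ofJ (hj.1 h), fun h => ?_⟩, ⟨fun h => ofJ ?_, fun h => ?_⟩, ⟨ofL, toL⟩,
    ⟨?_, fun h => ?_⟩,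
    ⟨?_, fun h => exists_isRieszFactorization hn0 hf.1.1 (toO h)⟩,
    ⟨fun h => ofA (hf.coeff_eq_of_wiener_ne_zero hn0 h), toO⟩,
    ⟨fun h => ofB fun k h1 h2 => coeff_eq_zero_of_eqOn_wiener hfd h h1 h2, hwf⟩,
    ⟨fun h => ofB (hab.2 fun k h1 h2 => coeff_eq_zero_of_eqOn_wiener hg.1 h.symm h1 h2),
      fun h => (wiener_eq_of_eqOn_pow hn0 (h := fun w => (w - 1) / (w + 1)) (hgC h)).symm⟩,
    by simp⟩
  · exact ofLc (h _ _ rfl (fun i hi => hi.2.2) hrec)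
  · rw [← h0]
    exact hr.eq_of_left_eq_zero hn0 fun k h1 h2 => hI k ⟨h1, h2, toB h k h1 h2⟩
  · exact ofLc (h _ _ rfl (fun i hi => hi.2.2) hrec)
  · rw [← h0]
    exact hr.eq_of_right_eq_zero hn0 fun k h1 h2 => hI k ⟨h1, h2, hab.1 (toB h) k h1 h2⟩
  · rintro ⟨H, k, hH, hb, hk, h⟩
    exact ofA (hf.coeff_eq_of_eqOn_cayley hn0 hg hH hb hk h)
  · exact ⟨fun _ => 1, n, by fun_prop, by simp, by omega, fun z hz => by simpa using hgC h hz⟩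
  · have h1 := coeff_eq_prod_roots (f := f) ha0 hn0
    rw [toA h] at h1
    exact (mul_eq_left₀ (by simpa using ha0)).1 h1.symm
  · rw [toI h, Polynomial.mem_nthRoots (by omega)] at hw
    exact norm_eq_one_of_pow_eq_neg_one hn0 hw
  · rw [h, Polynomial.mem_nthRoots (by omega)] at hw
    exact norm_eq_one_of_pow_eq_neg_one hn0 hw
  · rw [hj, toT h, mul_one, congrArg Complex.re (toLc h), hf0, Complex.re_ofReal_mul, toT h]
  · rw [← hsum, h, add_zero]
  · rw [Finset.sum_eq_zero fun j hj => by
      rw [toB h j (Finset.mem_Ico.1 hj).1 (Finset.mem_Ico.1 hj).2, zero_mul], Complex.zero_re]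
  · rintro ⟨hb, N, r, α, hrep, rfl, hr⟩
    exact ofB (hab.2 fun k h1 h2 => coeff_eq_zero_of_isAtomicRep hg hrep hr hb h1 h2)
  · obtain ⟨r, α, hrep, hr⟩ := exists_isAtomicRep hn0 h
    refine ⟨?_, n, r, α, hrep, rfl, hr⟩
    have h1 := congrArg Complex.re (toLc h)
    rw [toA h, hf0, Complex.re_ofReal_mul, Complex.re_mul_ofReal, Complex.re_ofNat, mul_comm] at h1
    rw [← mul_left_cancel₀ (Real.exp_pos (-t)).ne' h1, hg0, toT h]
    simp
  · rintro ⟨B, G, hBG, hB⟩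
    exact ofA (hf.coeff_eq_of_wiener_ne_zero hn0 fun z hz =>
      wiener_ne_zero_of_isRieszFactorization hn0 hf.1.1 hBG hB hz)

end Krzyz

theorem theorem1 (n : ℕ) (hn : 2 ≤ n) :
    -- standing facts: `a_n > 0`, and `f = e^g` with `b_0 < 0`
    (∀ f : ℂ → ℂ, Krzyz.IsExtremal n f →
      (Krzyz.coeff f n).im = 0 ∧ 0 < (Krzyz.coeff f n).re ∧ ∃ g, Krzyz.IsNormalizedLog f g) ∧
    -- part (I)
    (∀ f g : ℂ → ℂ, Krzyz.IsExtremal n f → Krzyz.IsNormalizedLog f g →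
      (Krzyz.conditions n f g).TFAE ∧
      ((∀ k, 1 ≤ k → k < n → Krzyz.coeff f k = 0) ↔
        (∀ k, 1 ≤ k → k < n → Krzyz.coeff g k = 0)) ∧
      (Set.EqOn f (Krzyz.krzyzFun n) Krzyz.disk → Krzyz.M n = 2 / Real.exp 1)) ∧
    -- part (II)
    List.TFAE [
      Krzyz.UniqueExtremal n,
      ∀ f g : ℂ → ℂ, Krzyz.IsExtremal n f → Krzyz.IsNormalizedLog f g →
        ∃ C ∈ Krzyz.conditions n f g, C,
      ∀ f g : ℂ → ℂ, Krzyz.IsExtremal n f → Krzyz.IsNormalizedLog f g →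
        ∀ C ∈ Krzyz.conditions n f g, C ] := by
  have hn0 : n ≠ 0 := by omega
  refine ⟨fun f hf => ⟨?_, ?_, hf.exists_log hn0⟩, fun f g hf hg =>
    ⟨Krzyz.conditions_tfae hn hf hg, ?_, fun h => ?_⟩, ?_⟩
  · rw [hf.coeff_eq_ofReal hn0, Complex.ofReal_im]
  · exact lt_of_lt_of_le (by positivity) (Krzyz.two_mul_exp_neg_one_le hn0 hf)
  · obtain ⟨t, -, -, hf0⟩ := hg.exists_pos
    exact (Krzyz.recursion_of_exp hg.1 hg.2.1 n).left_eq_zero_iff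
      (by rw [hf0]; exact_mod_cast (Real.exp_pos _).ne')
  · have hmax : IsGreatest {x : ℝ | ∃ f : ℂ → ℂ, Krzyz.BStar f ∧ x = ‖Krzyz.coeff f n‖}
        (Krzyz.coeff f n).re := by
      refine ⟨⟨f, hf.1.1, ?_⟩, ?_⟩
      · exact le_antisymm (Complex.re_le_norm _) (hf.norm_coeff_le_re hn0 hf.1.1)
      · rintro x ⟨h, hh, rfl⟩
        exact hf.norm_coeff_le_re hn0 hh
    rw [Krzyz.M, hmax.csSup_eq, Krzyz.coeff_congr h, Krzyz.coeff_krzyzFun_self hn0,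
      show (2 : ℂ) * Complex.exp (-1) = ((2 * Real.exp (-1) : ℝ) : ℂ) by push_cast; rfl,
      Complex.ofReal_re, Real.exp_neg, div_eq_mul_inv]
  · tfae_have 3 → 2 := fun h f g hf hg => by
      have := h f g hf hg
      simp only [Krzyz.conditions, List.exists_mem_cons_iff, List.forall_mem_cons] at this ⊢
      exact Or.inl this.1
    tfae_have 2 → 3 := fun h f g hf hg C hC => by
      obtain ⟨C', hC', hholds⟩ := h f g hf hg
      exact (Krzyz.conditions_tfae hn hf hg C' hC' C hC).1 hholds
    tfae_have 3 → 1 := fun h => by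
      have hall : ∀ f, Krzyz.IsExtremal n f → Set.EqOn f (Krzyz.krzyzFun n) Krzyz.disk :=
        fun f hf => by
          obtain ⟨g, hg⟩ := hf.exists_log hn0
          exact h f g hf hg _
            (List.mem_cons_of_mem _ (List.mem_cons_of_mem _ List.mem_cons_self))
      obtain ⟨f, hf⟩ := Krzyz.exists_isExtremal hn0
      exact ⟨f, hf, fun h hh => (hall h hh).trans (hall f hf).symm⟩
    tfae_have 1 → 2 := fun h f g hf hg => by
      exact ⟨∀ k, 1 ≤ k → k < n → Krzyz.coeff f k = 0, List.mem_cons_of_mem _ List.mem_cons_self,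
        fun k h1 h2 => Krzyz.coeff_eq_zero_of_uniqueExtremal h hf h1 h2⟩
    tfae_finish
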